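/- Let $\mathcal A$ be a non-empty finite or countable alphabet with the discrete topology, let $X=\mathcal A^{\mathbb N}$ carry the product topology and its Borel $\sigma$-field, and let $T:X\to X$, $T(x_1,x_2,\dots)=(x_2,x_3,\dots)$. Let $g(x)=g_0\prod_{n\ge 1}g_n(x_n)$ be a potential of product type, with a constant $g_0>0$ and functions $g_n:\mathcal A\to(0,\infty)$. Assume that $g$ is $\ell_1$-bounded, $\sum_{k\ge 2}\|\log g_k\|_\infty<\infty$, and summable, $\sum_{a\in\mathcal A}g_1(a)<\infty$. For $f:X\to\mathbb R$ let $\mathcal L_f\varphi(x)=\sum_{Ty=x}\varphi(y)e^{f(y)}$, and let $\mathcal L_f^*m$ be given by $\int\varphi\,d\mathcal L_f^*m=\int\mathcal L_f\varphi\,dm$ for bounded continuous $\varphi$. Put $$P(f)=\lim_{n\to\infty}\frac1n\log\sum_{w\in\mathcal A^n}\ \sup_{x\in[w]}\ \exp\Big(\sum_{i=0}^{n-1}f(T^ix)\Big),$$ where $[w]$ is the set of sequences that begin with the word $w$, and let $h_m(T)\in[0,\infty]$ be the Kolmogorov–Sinai entropy of a $T$-invariant probability measure $m$. Let $$\lambda=g_0\sum_{a\in\mathcal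 A}\prod_{k=1}^\infty g_k(a),\qquad \tilde g(x)=\frac{\prod_{i=1}^\infty g_i(x_1)}{\sum_{a\in\mathcal A}\prod_{i=1}^\infty g_i(a)},$$ let $\mu=\bigotimes_{n\ge1}\mu_n$ be the product measure, and $\tilde\mu$ the Bernoulli measure with weights $\tilde\mu_0(a)$, where $$\mu_n(a)=\frac{\prod_{i=1}^n g_i(a)}{\sum_{b\in\mathcal A}\prod_{i=1}^n g_i(b)},\qquad \tilde\mu_0(a)=\frac{\prod_{i=1}^\infty g_i(a)}{\sum_{b\in\mathcal A}\prod_{i=1}^\infty g_i(b)}.$$ 1. $\mu$ and $\tilde\mu$ are probability measures, $\tilde\mu$ is $T$-invariant, $\mathcal L_{\log g}^*\mu=\lambda\mu$, $\mathcal L_{\log\tilde g}^*\tilde\mu=\tilde\mu$, and the limit $P(\log g)$ exists and equals $\log\lambda$, with $0<\lambda<\infty$. Moreover $\int\log g\,d\tilde\mu$ exists in $[-\infty,\infty)$ and $h_{\tilde\mu}(T)=P(\log g)-\int\log g\,d\tilde\mu$ in $[0,\infty]$; in particular, if $h_{\tilde\mu}(T)<\infty$, then $\log g$ is $\tilde\mu$-integrable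 and $$P(\log g)=h_{\tilde\mu}(T)+\int\log g\,d\tilde\mu .$$ If $\mathcal A$ is finite, then $h_{\tilde\mu}(T)<\infty$ and $\tilde\mu$ is an equilibrium state, that is, it realizes the supremum of $h_m(T)+\int\log g\,dm$ over all $T$-invariant Borel probability measures $m$. 2. Suppose that $\mathcal A$ is finite, that $g$ is in balanced form, $\prod_{a\in\mathcal A}g_n(a)=1$ for all $n\ge1$, and that $g$ has $\ell_2$-bounded tails, i.e. $\sum_{i\ge k}\sup_{a\in\mathcal A}\big(\sum_{j\ge i}\log g_j(a)\big)^2<\infty$ for some $k$. Let $h_i(a)=\prod_{k>i}g_k(a)$. Then $h(x)=\prod_{i=1}^\infty h_i(x_i)=\lim_{N\to\infty}\prod_{i=1}^N h_i(x_i)$ exists in $(0,\infty)$ for almost every $x\in X$ with respect to the $(1/|\mathcal A|,\dots,1/|\mathcal A|)$-Bernoulli measure. Furthermore $\mathcal L_{\log g}h=\lambda h$: whenever $h(x)$ exists, $h(y)$ exists for every $y$ with $Ty=x$, and $\mathcal L_{\log g}h(x)=\lambda h(x)$. -/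

import Mathlib

open MeasureTheory Filter Topology
open scoped ENNReal

noncomputable section

namespace ProductType

/-! ### The one-sided full shift -/

/-- The one-sided full shift `A^ℕ`; the coordinate with index `n` here is the `(n+1)`-st letter. -/
abbrev Seq (A : Type*) : Type _ := ℕ → A

/-- The shift map `(x₁, x₂, …) ↦ (x₂, x₃, …)`. -/
def shift {A : Type*} (x : Seq A) : Seq A := fun n => x (n + 1)

/-- The cylinder set of a word of length `n`. -/
def cylinder {A : Type*} {n : ℕ} (w : Fin n → A) : Set (Seq A) :=
  {x | ∀ i : Fin n, x i = w i}

/-! ### Ruelle operator, its dual, and pressure -/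

/-- The Ruelle operator `(L_f φ)(x) = ∑_{T y = x} φ(y) exp (f y)`. -/
def ruelle {A : Type*} (f φ : Seq A → ℝ) (x : Seq A) : ℝ :=
  ∑' y : {y : Seq A // shift y = x}, φ y * Real.exp (f y)

/-- `ν = L_f^* m`: for every bounded continuous `φ` the function `L_f φ` is well defined
everywhere, is `m`-integrable, and `∫ L_f φ dm = ∫ φ dν`. -/
def IsDualImage {A : Type*} [TopologicalSpace A] [MeasurableSpace A]
    (f : Seq A → ℝ) (m ν : Measure (Seq A)) : Prop :=
  ∀ φ : BoundedContinuousFunction (Seq A) ℝ,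
    (∀ x : Seq A, Summable fun y : {y : Seq A // shift y = x} => φ y * Real.exp (f y)) ∧
    Integrable (ruelle f φ) m ∧
    ∫ x, ruelle f φ x ∂m = ∫ x, φ x ∂ν

/-- The partition function `∑_{w ∈ A^n} sup_{x ∈ [w]} exp (f x + f (T x) + ⋯ + f (T^{n-1} x))`. -/
def partitionFunction {A : Type*} (f : Seq A → ℝ) (n : ℕ) : ℝ≥0∞ :=
  ∑' w : Fin n → A, ⨆ x ∈ cylinder w,
    ENNReal.ofReal (∏ i ∈ Finset.range n, Real.exp (f (shift^[i] x)))

/-- The pressure of `f` exists as a limit and equals `P`. -/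
def HasPressure {A : Type*} (f : Seq A → ℝ) (P : EReal) : Prop :=
  Tendsto (fun n : ℕ => ENNReal.log (partitionFunction f n) / (n : EReal)) atTop (𝓝 P)

/-! ### Kolmogorov–Sinai entropy and equilibrium states -/

/-- The Shannon entropy `H_m(ξ ∨ T⁻¹ξ ∨ ⋯ ∨ T^{-(n-1)}ξ)` of the `n`-th refinement of a finite
partition, which is given by its labelling map `ξ : X → {0, …, k-1}`. -/
def refinedEntropy {X : Type*} [MeasurableSpace X] (m : Measure X) (T : X → X) {k : ℕ}
    (ξ : X → Fin k) (n : ℕ) : ℝ :=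
  ∑ w : Fin n → Fin k, Real.negMulLog (m.real {x | ∀ i : Fin n, ξ (T^[i] x) = w i})

/-- The Kolmogorov–Sinai entropy: the supremum of `lim (1/n) H_m(⋁_{i<n} T^{-i}ξ)` over all
finite measurable partitions `ξ` (for invariant `m` the limit exists by subadditivity). -/
def ksEntropy {X : Type*} [MeasurableSpace X] (m : Measure X) (T : X → X) : EReal :=
  ⨆ (k : ℕ) (ξ : X → Fin k) (_ : Measurable ξ),
    limsup (fun n : ℕ => ((refinedEntropy m T ξ n / n : ℝ) : EReal)) atTop

/-- The `T`-invariant Borel probability measures on the full shift. -/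
def invariantMeasures (A : Type*) [MeasurableSpace A] : Set (Measure (Seq A)) :=
  {m | IsProbabilityMeasure m ∧ MeasurePreserving shift m m}

/-- `m` is an equilibrium state of `f`: it is an invariant probability measure, and it realizes
the supremum of `h_{m'}(T) + ∫ f dm'` over all invariant probability measures `m'`. -/
def IsEquilibriumState {A : Type*} [MeasurableSpace A] (f : Seq A → ℝ)
    (m : Measure (Seq A)) : Prop :=
  m ∈ invariantMeasures A ∧
    IsGreatest
      ((fun m' : Measure (Seq A) => ksEntropy m' shift + ((∫ x, f x ∂m' : ℝ) : EReal)) ''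
        invariantMeasures A)
      (ksEntropy m shift + ((∫ x, f x ∂m : ℝ) : EReal))

/-- The extended integral `∫ f⁺ dm - ∫ f⁻ dm`, meaningful when one of the two is finite. -/
def extIntegral {X : Type*} [MeasurableSpace X] (m : Measure X) (f : X → ℝ) : EReal :=
  ((∫⁻ x, ENNReal.ofReal (f x) ∂m : ℝ≥0∞) : EReal) -
    ((∫⁻ x, ENNReal.ofReal (-f x) ∂m : ℝ≥0∞) : EReal)

/-! ### Measures of product type -/

/-- The measure on the alphabet that gives mass `p a` to the letter `a`. -/
def letterMeasure {A : Type*} [MeasurableSpace A] (p : A → ℝ) : Measure A :=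
  Measure.sum fun a => ENNReal.ofReal (p a) • Measure.dirac a

/-- The product measure whose `n`-th factor has the weights `p n`. -/
def productMeasure {A : Type*} [MeasurableSpace A] (p : ℕ → A → ℝ) : Measure (Seq A) :=
  Measure.infinitePi fun n => letterMeasure (p n)

/-! ### Potentials of product type -/

/-- The data of `g(x) = g₀ ∏_{n ≥ 1} g_n(x_n)` with `g₀ > 0` and `g_n > 0`;
`factor n` is `g_{n+1}`. -/
structure Potential (A : Type*) where
  const : ℝ
  const_pos : 0 < const
  factor : ℕ → A → ℝ
  factor_pos : ∀ n a, 0 < factor n a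

namespace Potential

variable {A : Type*} (g : Potential A)

/-- The function `g(x) = g₀ ∏_{n ≥ 1} g_n(x_n)`. -/
def eval (x : Seq A) : ℝ := g.const * ∏' n, g.factor n (x n)

/-- The function `log g`. -/
def logEval (x : Seq A) : ℝ := Real.log (g.eval x)

/-- `ℓ₁`-boundedness: `∑_{k ≥ 2} ‖log g_k‖_∞ < ∞`. -/
def L1Bounded : Prop := ∑' k : ℕ, ⨆ a : A, ‖Real.log (g.factor (k + 1) a)‖ₑ < ∞

/-- Summability: `∑_a g₁(a) < ∞`. -/
def IsSummable : Prop := Summable (g.factor 0)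

/-- `ℓ₂`-bounded tails: `∑_{i ≥ k} sup_a (∑_{j ≥ i} log g_j(a))² < ∞` for some `k`. -/
def L2BoundedTails : Prop :=
  ∃ k : ℕ, ∑' i : ℕ, ⨆ a : A,
    ENNReal.ofReal ((∑' j : ℕ, Real.log (g.factor (k + i + j) a)) ^ 2) < ∞

/-- Balanced form over a finite alphabet: `∏_a g_n(a) = 1` for all `n ≥ 1`. -/
def Balanced [Fintype A] : Prop := ∀ n, ∏ a, g.factor n a = 1

/-- `∏_{i=1}^∞ g_i(a)`. -/
def diag (a : A) : ℝ := ∏' i, g.factor i a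

/-- `λ = g₀ ∑_a ∏_{k=1}^∞ g_k(a)`. -/
def eigenvalue : ℝ := g.const * ∑' a, g.diag a

/-- The weights `μ_n(a)`, proportional to `∏_{i=1}^n g_i(a)`; `conformalWeight n` is `μ_{n+1}`. -/
def conformalWeight (n : ℕ) (a : A) : ℝ :=
  (∏ i ∈ Finset.range (n + 1), g.factor i a) / ∑' b, ∏ i ∈ Finset.range (n + 1), g.factor i b

/-- The weights `μ̃₀(a)`, proportional to `∏_{i=1}^∞ g_i(a)`. -/
def bernoulliWeight (a : A) : ℝ := g.diag a / ∑' b, g.diag b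

/-- The product measure `μ = ⊗ μ_n`. -/
def conformalMeasure [MeasurableSpace A] : Measure (Seq A) := productMeasure g.conformalWeight

/-- The Bernoulli measure `μ̃` with weights `μ̃₀`. -/
def bernoulliMeasure [MeasurableSpace A] : Measure (Seq A) :=
  productMeasure fun _ => g.bernoulliWeight

/-- The logarithm of `g̃(x) = ∏_i g_i(x₁) / ∑_a ∏_i g_i(a)`. -/
def logNormalized (x : Seq A) : ℝ := Real.log (g.diag (x 0) / ∑' a, g.diag a)

/-- `h_i(a) = ∏_{k > i} g_k(a)`; `eigenFactor i` is `h_{i+1}`. -/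
def eigenFactor (i : ℕ) (a : A) : ℝ := ∏' k, g.factor (i + 1 + k) a

/-- The product `h(x) = ∏_{i ≥ 1} h_i(x_i)` converges (possibly only conditionally) to the
value `c`, which, as for every convergent infinite product, has to be non-zero, so positive. -/
def EigenfunctionHasValue (x : Seq A) (c : ℝ) : Prop :=
  0 < c ∧ Tendsto (fun N : ℕ => ∏ i ∈ Finset.range N, g.eigenFactor i (x i)) atTop (𝓝 c)

/-- `h(x)` exists. -/
def EigenfunctionExistsAt (x : Seq A) : Prop := ∃ c, g.EigenfunctionHasValue x c

/-- The function `h`, the limit of the partial products wherever it exists. -/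
def eigenfunction (x : Seq A) : ℝ :=
  limUnder atTop fun N : ℕ => ∏ i ∈ Finset.range N, g.eigenFactor i (x i)

end Potential

/-- The `(1/|A|, …, 1/|A|)`-Bernoulli measure. -/
def uniformBernoulli (A : Type*) [Fintype A] [MeasurableSpace A] : Measure (Seq A) :=
  productMeasure fun _ _ => 1 / (Fintype.card A : ℝ)

end ProductType

end

/-!
Two facts about `g` carry the proof. By `ℓ₁`-boundedness `g` agrees, up to a factor which tends to
`1` uniformly, with its truncation to the first `n` coordinates, for which the masses of cylinders
under `L_{log g}^* μ` and the partition function are explicit. And `log g` is cohomologous to a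
function of the first letter,
`log g(x) = log λ + log μ̃₀(x₁) + ∑_{k ≥ 2} (log g_k(x_k) - log g_k(x₁))`,
where the last sum is bounded and has integral zero for every invariant measure. Thus
`∫ log g dm = log λ + ∫ log μ̃₀(x₁) dm`, and the variational principle becomes the Gibbs inequality
`h_m(T) ≤ -∫ log μ̃₀(x₁) dm`, with equality for `m = μ̃`.

To prove this inequality for an arbitrary finite partition `ξ`, approximate `ξ` by a function `ζ` of
finitely many letters, and compare the law of the `ξ`-itinerary under `m` with the law of the
`ζ`-itinerary under `μ̃` after each label has been replaced by a random one with probability `η`.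
The noise pays for the labels at which `ξ` and `ζ` differ; its cost per label tends to `0` with `η`.

For the eigenfunction, `g(ax) h(ax) = (g₀ ∏_i g_i(a)) h(x)` sums over `a` to the eigenvalue
equation, and in balanced form the `log h_i(x_i)` are independent, centred and have summable
variances, so that their sum converges almost surely.
-/

noncomputable section

namespace ProductType

/-! ### Sequences and cylinders -/

section Shift

variable {A : Type*}

/-- The sequence `(a, x₁, x₂, …)`; the sequences `cons a x`, `a : A`, are the preimages of `x`
under the shift. -/
def cons (a : A) (x : Seq A) : Seq A
  | 0 => a
  | n + 1 => x n

@[simp] lemma cons_zero (a : A) (x : Seq A) : cons a x 0 = a := rfl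

@[simp] lemma cons_succ (a : A) (x : Seq A) (n : ℕ) : cons a x (n + 1) = x n := rfl

lemma cons_shift (x : Seq A) : cons (x 0) (shift x) = x := by
  funext n; cases n <;> rfl

lemma shift_iterate_apply (i : ℕ) (x : Seq A) (n : ℕ) : shift^[i] x n = x (n + i) := by
  induction i generalizing x with
  | zero => rfl
  | succ i ih => rw [Function.iterate_succ_apply, ih, shift, add_assoc]

/-- The letters index the preimages of a sequence under the shift. -/
def preimageEquiv (x : Seq A) : A ≃ {y : Seq A // shift y = x} where
  toFun a := ⟨cons a x, rfl⟩
  invFun y := y.1 0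
  left_inv _ := rfl
  right_inv := by
    rintro ⟨y, rfl⟩
    exact Subtype.ext (cons_shift y)

lemma ruelle_eq_tsum (f φ : Seq A → ℝ) (x : Seq A) :
    ruelle f φ x = ∑' a, φ (cons a x) * Real.exp (f (cons a x)) :=
  ((preimageEquiv x).tsum_eq fun y => φ y * Real.exp (f y)).symm

/-- The word formed by the first `n` letters of a sequence. -/
def word (n : ℕ) (x : Seq A) : Fin n → A := fun i => x i

lemma word_eq_word_iff {n : ℕ} {x y : Seq A} : word n x = word n y ↔ ∀ i < n, x i = y i := by
  simp [word, funext_iff, Fin.forall_iff]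

lemma word_surjective [Nonempty A] (n : ℕ) : Function.Surjective (word n : Seq A → Fin n → A) :=
  fun w => ⟨fun i => if h : i < n then w ⟨i, h⟩ else Classical.arbitrary A, by
    ext i; simp [word]⟩

lemma cylinder_eq_preimage {n : ℕ} (w : Fin n → A) : cylinder w = word n ⁻¹' {w} := by
  ext x; simp [cylinder, word, funext_iff]

lemma mem_cylinder_word {n : ℕ} {x y : Seq A} :
    y ∈ cylinder (word n x) ↔ ∀ i < n, y i = x i := by
  rw [cylinder_eq_preimage, Set.mem_preimage, Set.mem_singleton_iff, word_eq_word_iff]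

lemma cons_mem_cylinder_word {n : ℕ} {a : A} {x y : Seq A} :
    cons a y ∈ cylinder (word (n + 1) x) ↔ a = x 0 ∧ y ∈ cylinder (word n (shift x)) := by
  simp [cylinder, word, shift, Fin.forall_fin_succ]

lemma cylinder_word_eq_pi (n : ℕ) (x : Seq A) :
    cylinder (word n x) = Set.pi (Finset.range n) fun i => {x i} := by
  ext y
  simp [mem_cylinder_word]

lemma exists_preimage_word_of_mem_measurableCylinders [MeasurableSpace A] {t : Set (Seq A)}
    (ht : t ∈ measurableCylinders fun _ : ℕ => A) :
    ∃ N, ∀ n ≥ N, ∃ S : Set (Fin n → A), t = word n ⁻¹' S := by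
  obtain ⟨s, S, -, rfl⟩ := (mem_measurableCylinders t).1 ht
  obtain ⟨N, hN⟩ := s.exists_nat_subset_range
  have hlt {n : ℕ} (hn : n ≥ N) (i : s) : (i : ℕ) < n :=
    (Finset.mem_range.1 (hN i.2)).trans_le hn
  exact ⟨N, fun n hn => ⟨{v | (fun i : s => v ⟨i, hlt hn i⟩) ∈ S}, rfl⟩⟩

end Shift

section CylinderMeasures

variable {A : Type*} [MeasurableSpace A]

@[fun_prop]
lemma measurable_shift : Measurable (shift : Seq A → Seq A) :=
  measurable_pi_lambda _ fun n => measurable_pi_apply (n + 1)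

@[fun_prop]
lemma measurable_cons (a : A) : Measurable (cons a : Seq A → Seq A) :=
  measurable_pi_lambda _ fun n => by cases n <;> simp only [cons_zero, cons_succ] <;> fun_prop

@[fun_prop]
lemma measurable_word (n : ℕ) : Measurable (word n : Seq A → Fin n → A) :=
  measurable_pi_lambda _ fun i => measurable_pi_apply (i : ℕ)

variable [MeasurableSingletonClass A]

lemma measurableSet_cylinder {n : ℕ} (w : Fin n → A) : MeasurableSet (cylinder w) := by
  rw [cylinder_eq_preimage]
  exact measurable_word n (measurableSet_singleton w)

variable [Countable A]

lemma tsum_measure_cylinder (M : Measure (Seq A)) {n : ℕ} (S : Set (Fin n → A)) :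
    ∑' w : S, M (cylinder (w : Fin n → A)) = M (word n ⁻¹' S) := by
  simp only [cylinder_eq_preimage]
  exact tsum_measure_preimage_singleton S.to_countable
    fun w _ => measurable_word n (measurableSet_singleton w)

lemma tsum_measure_cylinder_univ (M : Measure (Seq A)) (n : ℕ) :
    ∑' w : Fin n → A, M (cylinder w) = M Set.univ := by
  rw [← tsum_univ fun w : Fin n → A => M (cylinder w), tsum_measure_cylinder, Set.preimage_univ]

lemma measure_preimage_word_mono {M N : Measure (Seq A)} {n : ℕ}
    (h : ∀ w : Fin n → A, M (cylinder w) ≤ N (cylinder w)) (S : Set (Fin n → A)) :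
    M (word n ⁻¹' S) ≤ N (word n ⁻¹' S) := by
  rw [← tsum_measure_cylinder M, ← tsum_measure_cylinder N]
  exact ENNReal.tsum_le_tsum fun w => h w

lemma eq_smul_of_cylinder_bounds {M N : Measure (Seq A)} [IsFiniteMeasure N] {a b : ℕ → ℝ≥0∞}
    {c : ℝ≥0∞} (hc : c ≠ ∞) (ha : Tendsto a atTop (𝓝 c)) (hb : Tendsto b atTop (𝓝 c))
    (hlower : ∀ (n : ℕ) (w : Fin (n + 1) → A), a n * N (cylinder w) ≤ M (cylinder w))
    (hupper : ∀ (n : ℕ) (w : Fin (n + 1) → A), M (cylinder w) ≤ b n * N (cylinder w)) :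
    M = c • N := by
  have heq : ∀ t ∈ measurableCylinders fun _ : ℕ => A, M t = (c • N) t := by
    intro t ht
    obtain ⟨l, hl⟩ := exists_preimage_word_of_mem_measurableCylinders ht
    refine le_antisymm
      (ge_of_tendsto (ENNReal.Tendsto.mul_const hb (.inr (measure_ne_top N t))) ?_)
      (le_of_tendsto (ENNReal.Tendsto.mul_const ha (.inr (measure_ne_top N t))) ?_)
    all_goals
      filter_upwards [eventually_ge_atTop l] with n hn
      obtain ⟨S, rfl⟩ := hl (n + 1) (Nat.le_succ_of_le hn)
    · exact measure_preimage_word_mono (N := b n • N) (hupper n) S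
    · exact measure_preimage_word_mono (M := a n • N) (hlower n) S
  have : IsFiniteMeasure (c • N) := Measure.smul_finite N hc
  have : IsFiniteMeasure M :=
    ⟨by rw [heq _ (univ_mem_measurableCylinders _)]; exact measure_lt_top _ _⟩
  exact ext_of_generate_finite _ generateFrom_measurableCylinders.symm
    isPiSystem_measurableCylinders heq (heq _ (univ_mem_measurableCylinders _))

end CylinderMeasures

/-- A probability vector on a possibly infinite alphabet: non-negative weights of total mass one. -/
structure IsProbabilityVector {A : Type*} (p : A → ℝ) : Prop where
  nonneg : ∀ a, 0 ≤ p a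
  hasSum : HasSum p 1

lemma IsProbabilityVector.le_one {A : Type*} {p : A → ℝ} (hp : IsProbabilityVector p) (a : A) :
    p a ≤ 1 :=
  le_hasSum hp.hasSum a fun b _ => hp.nonneg b

section ProductMeasures

variable {A : Type*} [MeasurableSpace A]

lemma infinitePi_cylinder_word [MeasurableSingletonClass A] (ν : ℕ → Measure A)
    [∀ n, IsProbabilityMeasure (ν n)] (n : ℕ) (x : Seq A) :
    Measure.infinitePi ν (cylinder (word n x)) = ∏ i ∈ Finset.range n, ν i {x i} := by
  rw [cylinder_word_eq_pi, Measure.infinitePi_pi _ fun _ _ => measurableSet_singleton _]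

lemma measurePreserving_shift_infinitePi (ν : Measure A) [IsProbabilityMeasure ν] :
    MeasurePreserving shift (Measure.infinitePi fun _ : ℕ => ν)
      (Measure.infinitePi fun _ : ℕ => ν) :=
  ⟨measurable_shift, Measure.map_infinitePi_infinitePi_of_inj (add_left_injective 1)⟩

lemma IsProbabilityVector.isProbabilityMeasure_letterMeasure {p : A → ℝ}
    (hp : IsProbabilityVector p) :
    IsProbabilityMeasure (letterMeasure p) := by
  constructor
  simp only [letterMeasure, Measure.sum_apply _ MeasurableSet.univ, Measure.smul_apply,
    measure_univ, smul_eq_mul, mul_one]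
  rw [← ENNReal.ofReal_tsum_of_nonneg hp.nonneg hp.hasSum.summable, hp.hasSum.tsum_eq,
    ENNReal.ofReal_one]

lemma isProbabilityMeasure_productMeasure {p : ℕ → A → ℝ} (hp : ∀ n, IsProbabilityVector (p n)) :
    IsProbabilityMeasure (productMeasure p) := by
  have := fun n => (hp n).isProbabilityMeasure_letterMeasure
  unfold productMeasure
  infer_instance

lemma measurePreserving_eval_productMeasure {p : ℕ → A → ℝ}
    (hp : ∀ n, IsProbabilityVector (p n)) (n : ℕ) :
    MeasurePreserving (fun x : Seq A => x n) (productMeasure p) (letterMeasure (p n)) := by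
  have := fun n => (hp n).isProbabilityMeasure_letterMeasure
  exact measurePreserving_eval_infinitePi _ n

lemma IsProbabilityVector.productMeasure_mem_invariantMeasures {p : A → ℝ}
    (hp : IsProbabilityVector p) :
    productMeasure (fun _ => p) ∈ invariantMeasures A :=
  have := hp.isProbabilityMeasure_letterMeasure
  ⟨isProbabilityMeasure_productMeasure fun _ => hp, measurePreserving_shift_infinitePi _⟩

variable [MeasurableSingletonClass A]

lemma letterMeasure_singleton (p : A → ℝ) (a : A) :
    letterMeasure p {a} = ENNReal.ofReal (p a) := by
  rw [letterMeasure, Measure.sum_apply _ (measurableSet_singleton a), tsum_eq_single a]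
  · simp
  · intro b hb
    simp [hb]

lemma productMeasure_cylinder_word {p : ℕ → A → ℝ} (hp : ∀ n, IsProbabilityVector (p n))
    (n : ℕ) (x : Seq A) :
    productMeasure p (cylinder (word n x)) =
      ENNReal.ofReal (∏ i ∈ Finset.range n, p i (x i)) := by
  have := fun n => (hp n).isProbabilityMeasure_letterMeasure
  rw [productMeasure, infinitePi_cylinder_word,
    ENNReal.ofReal_prod_of_nonneg fun i _ => (hp i).nonneg _]
  simp only [letterMeasure_singleton]

end ProductMeasures

/-! ### Truncations of the potential -/

namespace Potential

variable {A : Type*} (g : Potential A)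

/-- The uniform bound `‖log g_{k+2}‖_∞`, as a real number. -/
def logBound (k : ℕ) : ℝ := (⨆ a : A, ‖Real.log (g.factor (k + 1) a)‖ₑ).toReal

/-- The tail `∑_{k ≥ n + 2} ‖log g_k‖_∞`, which bounds the logarithm of the part of `g` that depends
on the coordinates after the first `n + 1`. -/
def tailBound (n : ℕ) : ℝ := ∑' k, g.logBound (n + k)

/-- The truncation `g₀ ∏_{k ≤ n+1} g_k(x_k)` of `g` to the first `n + 1` coordinates. -/
def partialEval (n : ℕ) (x : Seq A) : ℝ := g.const * ∏ k ∈ Finset.range (n + 1), g.factor k (x k)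

/-- The analogue `g₀ ∑_a ∏_{k ≤ n+1} g_k(a)` of `λ` for the truncation of `g`. -/
def partialEigenvalue (n : ℕ) : ℝ := ∑' a, g.partialEval n fun _ => a

variable {g}

lemma partialEval_pos (n : ℕ) (x : Seq A) : 0 < g.partialEval n x :=
  mul_pos g.const_pos (Finset.prod_pos fun k _ => g.factor_pos k _)

lemma partialEval_succ (n : ℕ) (x : Seq A) :
    g.partialEval (n + 1) x = g.partialEval n x * g.factor (n + 1) (x (n + 1)) := by
  rw [partialEval, Finset.prod_range_succ, ← mul_assoc, partialEval]

lemma log_partialEval (n : ℕ) (x : Seq A) :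
    Real.log (g.partialEval n x) =
      Real.log g.const + ∑ k ∈ Finset.range (n + 1), Real.log (g.factor k (x k)) := by
  rw [partialEval, Real.log_mul g.const_pos.ne'
    (Finset.prod_pos fun k _ => g.factor_pos k _).ne',
    Real.log_prod fun k _ => (g.factor_pos k _).ne']

lemma eigenvalue_eq_tsum : g.eigenvalue = ∑' a, g.eval fun _ => a :=
  tsum_mul_left.symm

lemma bernoulliWeight_eq (a : A) : g.bernoulliWeight a = g.eval (fun _ => a) / g.eigenvalue :=
  (mul_div_mul_left _ _ g.const_pos.ne').symm

lemma conformalWeight_eq (n : ℕ) (a : A) :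
    g.conformalWeight n a = g.partialEval n (fun _ => a) / g.partialEigenvalue n := by
  simp only [partialEigenvalue, partialEval]
  rw [tsum_mul_left, mul_div_mul_left _ _ g.const_pos.ne', conformalWeight]

lemma partialEval_cons {n : ℕ} {x y : Seq A} (hy : y ∈ cylinder (word n (shift x))) :
    g.partialEval n (cons (x 0) y) = g.partialEval n x := by
  rw [mem_cylinder_word] at hy
  simp only [partialEval, Finset.prod_range_succ', cons_succ, cons_zero]
  rw [Finset.prod_congr rfl fun k hk => by rw [hy k (Finset.mem_range.1 hk)]]
  rfl

lemma tendsto_tailBound : Tendsto g.tailBound atTop (𝓝 0) :=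
  (tendsto_sum_nat_add g.logBound).congr fun n => by simp only [tailBound, add_comm]

namespace L1Bounded

lemma summable_logBound (hg : g.L1Bounded) : Summable g.logBound :=
  ENNReal.summable_toReal hg.ne

lemma abs_log_factor_le (hg : g.L1Bounded) (k : ℕ) (a : A) :
    |Real.log (g.factor (k + 1) a)| ≤ g.logBound k := by
  have hfin : (⨆ a : A, ‖Real.log (g.factor (k + 1) a)‖ₑ) ≠ ∞ :=
    ENNReal.ne_top_of_tsum_ne_top hg.ne k
  simpa [logBound] using ENNReal.toReal_mono hfin
    (le_iSup (fun a : A => ‖Real.log (g.factor (k + 1) a)‖ₑ) a)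

lemma summable_logBound_add (hg : g.L1Bounded) (n : ℕ) : Summable fun k => g.logBound (n + k) :=
  hg.summable_logBound.comp_injective (add_right_injective n)

lemma summable_log_factor (hg : g.L1Bounded) (x : Seq A) :
    Summable fun n => Real.log (g.factor n (x n)) := by
  rw [← summable_nat_add_iff 1]
  exact .of_norm_bounded hg.summable_logBound fun k => hg.abs_log_factor_le k _

lemma eval_eq (hg : g.L1Bounded) (x : Seq A) :
    g.eval x = g.const * Real.exp (∑' n, Real.log (g.factor n (x n))) := by
  rw [eval, Real.rexp_tsum_eq_tprod (fun n => g.factor_pos n _) (hg.summable_log_factor x)]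

lemma eval_pos (hg : g.L1Bounded) (x : Seq A) : 0 < g.eval x := by
  rw [hg.eval_eq]; exact mul_pos g.const_pos (Real.exp_pos _)

lemma exp_logEval (hg : g.L1Bounded) (x : Seq A) : Real.exp (g.logEval x) = g.eval x :=
  Real.exp_log (hg.eval_pos x)

lemma logEval_eq (hg : g.L1Bounded) (x : Seq A) :
    g.logEval x = Real.log g.const + ∑' n, Real.log (g.factor n (x n)) := by
  rw [logEval, hg.eval_eq, Real.log_mul g.const_pos.ne' (Real.exp_ne_zero _), Real.log_exp]

lemma abs_logEval_sub_log_partialEval_le (hg : g.L1Bounded) (n : ℕ) (x : Seq A) :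
    |g.logEval x - Real.log (g.partialEval n x)| ≤ g.tailBound n := by
  rw [hg.logEval_eq, log_partialEval, ← (hg.summable_log_factor x).sum_add_tsum_nat_add (n + 1),
    ← add_assoc, add_sub_cancel_left, ← Real.norm_eq_abs]
  refine tsum_of_norm_bounded (hg.summable_logBound_add n).hasSum fun k => ?_
  rw [← add_assoc, add_comm k]
  exact hg.abs_log_factor_le (n + k) _

lemma eval_le (hg : g.L1Bounded) (n : ℕ) (x : Seq A) :
    g.eval x ≤ Real.exp (g.tailBound n) * g.partialEval n x := by
  rw [← Real.log_le_log_iff (hg.eval_pos x) (mul_pos (Real.exp_pos _) (partialEval_pos n x)),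
    Real.log_mul (Real.exp_ne_zero _) (partialEval_pos n x).ne', Real.log_exp]
  linarith [(abs_le.1 (hg.abs_logEval_sub_log_partialEval_le n x)).2, logEval.eq_1 g x]

lemma le_eval (hg : g.L1Bounded) (n : ℕ) (x : Seq A) :
    Real.exp (-g.tailBound n) * g.partialEval n x ≤ g.eval x := by
  rw [← Real.log_le_log_iff (mul_pos (Real.exp_pos _) (partialEval_pos n x)) (hg.eval_pos x),
    Real.log_mul (Real.exp_ne_zero _) (partialEval_pos n x).ne', Real.log_exp]
  linarith [(abs_le.1 (hg.abs_logEval_sub_log_partialEval_le n x)).1, logEval.eq_1 g x]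

lemma partialEval_le (hg : g.L1Bounded) (n : ℕ) (x : Seq A) :
    g.partialEval n x ≤ Real.exp (g.tailBound n) * g.eval x := by
  have h := hg.le_eval n x
  rwa [Real.exp_neg, inv_mul_le_iff₀ (Real.exp_pos _)] at h

lemma summable_eval_const (hg : g.L1Bounded) (hs : g.IsSummable) :
    Summable fun a => g.eval fun _ => a := by
  refine .of_nonneg_of_le (fun a => (hg.eval_pos _).le) (fun a => hg.eval_le 0 _) ?_
  simpa [partialEval] using ((hs : Summable (g.factor 0)).mul_left g.const).mul_left _

lemma summable_partialEval_const (hg : g.L1Bounded) (hs : g.IsSummable) (n : ℕ) :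
    Summable fun a => g.partialEval n fun _ => a :=
  .of_nonneg_of_le (fun _ => (partialEval_pos n _).le) (fun _ => hg.partialEval_le n _)
    ((hg.summable_eval_const hs).mul_left _)

lemma tendsto_partialEigenvalue (hg : g.L1Bounded) (hs : g.IsSummable) :
    Tendsto g.partialEigenvalue atTop (𝓝 g.eigenvalue) := by
  have hexp : Tendsto (fun n => Real.exp (g.tailBound n)) atTop (𝓝 1) := by
    simpa using (tendsto_tailBound (g := g)).rexp
  have hexp_neg : Tendsto (fun n => Real.exp (-g.tailBound n)) atTop (𝓝 1) := by
    simpa using (tendsto_tailBound (g := g)).neg.rexp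
  refine tendsto_of_tendsto_of_tendsto_of_le_of_le
    (by simpa using hexp_neg.mul_const g.eigenvalue)
    (by simpa using hexp.mul_const g.eigenvalue) (fun n => ?_) (fun n => ?_)
  · simp only [eigenvalue_eq_tsum, ← tsum_mul_left]
    refine ((hg.summable_eval_const hs).mul_left _).tsum_le_tsum (fun a => ?_)
      (hg.summable_partialEval_const hs n)
    rw [Real.exp_neg, inv_mul_le_iff₀ (Real.exp_pos _)]
    exact hg.eval_le n _
  · simp only [eigenvalue_eq_tsum, ← tsum_mul_left]
    exact (hg.summable_partialEval_const hs n).tsum_le_tsum (fun a => hg.partialEval_le n _)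
      ((hg.summable_eval_const hs).mul_left _)

variable [Nonempty A]

lemma eigenvalue_pos (hg : g.L1Bounded) (hs : g.IsSummable) : 0 < g.eigenvalue := by
  rw [eigenvalue_eq_tsum]
  exact (hg.summable_eval_const hs).tsum_pos (fun _ => (hg.eval_pos _).le)
    (Classical.arbitrary A) (hg.eval_pos _)

lemma partialEigenvalue_pos (hg : g.L1Bounded) (hs : g.IsSummable) (n : ℕ) :
    0 < g.partialEigenvalue n :=
  (hg.summable_partialEval_const hs n).tsum_pos (fun _ => (partialEval_pos n _).le)
    (Classical.arbitrary A) (partialEval_pos n _)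

lemma conformalWeight_pos (hg : g.L1Bounded) (hs : g.IsSummable) (n : ℕ) (a : A) :
    0 < g.conformalWeight n a := by
  rw [conformalWeight_eq]
  exact div_pos (partialEval_pos n _) (hg.partialEigenvalue_pos hs n)

lemma isProbabilityVector_conformalWeight (hg : g.L1Bounded) (hs : g.IsSummable) (n : ℕ) :
    IsProbabilityVector (g.conformalWeight n) where
  nonneg a := (hg.conformalWeight_pos hs n a).le
  hasSum := by
    have h := (hg.summable_partialEval_const hs n).hasSum.div_const (g.partialEigenvalue n)
    rw [← partialEigenvalue, div_self (hg.partialEigenvalue_pos hs n).ne'] at h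
    simpa only [← conformalWeight_eq] using h

lemma bernoulliWeight_pos (hg : g.L1Bounded) (hs : g.IsSummable) (a : A) :
    0 < g.bernoulliWeight a := by
  rw [bernoulliWeight_eq]
  exact div_pos (hg.eval_pos _) (hg.eigenvalue_pos hs)

lemma exp_logNormalized (hg : g.L1Bounded) (hs : g.IsSummable) (x : Seq A) :
    Real.exp (g.logNormalized x) = g.bernoulliWeight (x 0) :=
  Real.exp_log (hg.bernoulliWeight_pos hs (x 0))

lemma isProbabilityVector_bernoulliWeight (hg : g.L1Bounded) (hs : g.IsSummable) :
    IsProbabilityVector g.bernoulliWeight where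
  nonneg a := (hg.bernoulliWeight_pos hs a).le
  hasSum := by
    have h := (hg.summable_eval_const hs).hasSum.div_const g.eigenvalue
    rw [← eigenvalue_eq_tsum, div_self (hg.eigenvalue_pos hs).ne'] at h
    simpa only [← bernoulliWeight_eq] using h

lemma partialEigenvalue_mul_conformalWeight (hg : g.L1Bounded) (hs : g.IsSummable) (n : ℕ)
    (a : A) : g.partialEigenvalue n * g.conformalWeight n a = g.partialEval n fun _ => a := by
  rw [conformalWeight_eq, mul_div_cancel₀ _ (hg.partialEigenvalue_pos hs n).ne']

lemma partialEval_mul_prod_conformalWeight (hg : g.L1Bounded) (hs : g.IsSummable) (n : ℕ)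
    (x : Seq A) :
    g.partialEval n x * ∏ i ∈ Finset.range n, g.conformalWeight i (x (i + 1)) =
      g.partialEigenvalue n * ∏ k ∈ Finset.range (n + 1), g.conformalWeight k (x k) := by
  induction n with
  | zero => simp [hg.partialEigenvalue_mul_conformalWeight hs, partialEval]
  | succ n ih =>
    have hstep := partialEval_succ (g := g) n fun _ => x (n + 1)
    rw [← hg.partialEigenvalue_mul_conformalWeight hs,
      ← hg.partialEigenvalue_mul_conformalWeight hs] at hstep
    rw [Finset.prod_range_succ, Finset.prod_range_succ _ (n + 1), partialEval_succ]
    linear_combination g.factor (n + 1) (x (n + 1)) * g.conformalWeight n (x (n + 1)) * ih -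
      (∏ k ∈ Finset.range (n + 1), g.conformalWeight k (x k)) * hstep

end L1Bounded
end Potential

/-! ### The dual operator -/

section DualMeasure

variable {A : Type*} [MeasurableSpace A]

/-- The measure `L_f^* m` as an explicit sum: its part on the sequences that begin with `a` is the
image under `cons a` of `m` weighted by `exp (f (cons a x))`. -/
def dualMeasure (f : Seq A → ℝ) (m : Measure (Seq A)) : Measure (Seq A) :=
  .sum fun a => (m.withDensity fun x => ENNReal.ofReal (Real.exp (f (cons a x)))).map (cons a)

section Cylinder

variable [MeasurableSingletonClass A] (f : Seq A → ℝ) (m : Measure (Seq A)) {n : ℕ} {x : Seq A}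

lemma dualMeasure_cylinder_word (n : ℕ) (x : Seq A) :
    dualMeasure f m (cylinder (word (n + 1) x)) =
      ∫⁻ y in cylinder (word n (shift x)), ENNReal.ofReal (Real.exp (f (cons (x 0) y))) ∂m := by
  have hpre (a : A) : cons a ⁻¹' cylinder (word (n + 1) x) =
      {_y | a = x 0} ∩ cylinder (word n (shift x)) := by
    ext y
    exact cons_mem_cylinder_word
  rw [dualMeasure, Measure.sum_apply _ (measurableSet_cylinder _), tsum_eq_single (x 0)]
  · rw [Measure.map_apply (measurable_cons _) (measurableSet_cylinder _), hpre,
      withDensity_apply _ (by simpa using measurableSet_cylinder _)]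
    simp
  · intro a ha
    rw [Measure.map_apply (measurable_cons _) (measurableSet_cylinder _), hpre]
    simp [ha]

variable {f} {c : ℝ}

lemma dualMeasure_cylinder_word_le
    (h : ∀ y ∈ cylinder (word n (shift x)), Real.exp (f (cons (x 0) y)) ≤ c) :
    dualMeasure f m (cylinder (word (n + 1) x)) ≤
      ENNReal.ofReal c * m (cylinder (word n (shift x))) := by
  rw [dualMeasure_cylinder_word, ← setLIntegral_const]
  exact setLIntegral_mono measurable_const fun y hy => ENNReal.ofReal_le_ofReal (h y hy)

lemma le_dualMeasure_cylinder_word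
    (h : ∀ y ∈ cylinder (word n (shift x)), c ≤ Real.exp (f (cons (x 0) y))) :
    ENNReal.ofReal c * m (cylinder (word n (shift x))) ≤
      dualMeasure f m (cylinder (word (n + 1) x)) := by
  rw [dualMeasure_cylinder_word, ← setLIntegral_const]
  exact setLIntegral_mono' (measurableSet_cylinder _) fun y hy =>
    ENNReal.ofReal_le_ofReal (h y hy)

end Cylinder

variable {f : Seq A → ℝ} (m : Measure (Seq A))

lemma integral_dualMeasure (hf : Measurable f) {φ : Seq A → ℝ} (hφ : Measurable φ)
    (hφi : Integrable φ (dualMeasure f m)) :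
    ∫ x, φ x ∂dualMeasure f m = ∑' a, ∫ x, φ (cons a x) * Real.exp (f (cons a x)) ∂m := by
  rw [dualMeasure, integral_sum_measure hφi]
  refine tsum_congr fun a => ?_
  rw [integral_map (measurable_cons a).aemeasurable hφ.aestronglyMeasurable,
    integral_withDensity_eq_integral_toReal_smul (by fun_prop)
      (ae_of_all _ fun x => ENNReal.ofReal_lt_top)]
  simp only [ENNReal.toReal_ofReal (Real.exp_pos _).le, smul_eq_mul, mul_comm]

variable [IsFiniteMeasure m] {b : A → ℝ}

lemma isFiniteMeasure_dualMeasure (hb : Summable b)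
    (hfb : ∀ a x, Real.exp (f (cons a x)) ≤ b a) : IsFiniteMeasure (dualMeasure f m) := by
  constructor
  rw [dualMeasure, Measure.sum_apply _ .univ]
  calc ∑' a, (m.withDensity fun x => ENNReal.ofReal (Real.exp (f (cons a x)))).map (cons a) Set.univ
      = ∑' a, ∫⁻ x, ENNReal.ofReal (Real.exp (f (cons a x))) ∂m := by
        refine tsum_congr fun a => ?_
        rw [Measure.map_apply (measurable_cons a) .univ, Set.preimage_univ,
          withDensity_apply _ .univ, setLIntegral_univ]
    _ ≤ ∑' a, ENNReal.ofReal (b a) * m Set.univ := by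
        gcongr with a
        rw [← lintegral_const]
        exact lintegral_mono fun x => ENNReal.ofReal_le_ofReal (hfb a x)
    _ < ∞ := by
        rw [ENNReal.tsum_mul_right]
        exact ENNReal.mul_lt_top hb.tsum_ofReal_lt_top (measure_lt_top m _)

lemma isDualImage_dualMeasure [TopologicalSpace A] [OpensMeasurableSpace (Seq A)] [Countable A]
    (hf : Measurable f) (hb : Summable b) (hfb : ∀ a x, Real.exp (f (cons a x)) ≤ b a) :
    IsDualImage f m (dualMeasure f m) := by
  intro φ
  have hφ : Measurable φ := φ.continuous.measurable
  set F : A → Seq A → ℝ := fun a x => φ (cons a x) * Real.exp (f (cons a x)) with hF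
  have hF_meas (a : A) : Measurable (F a) := by fun_prop
  have hF_le (a : A) (x : Seq A) : ‖F a x‖ ≤ ‖φ‖ * b a := by
    rw [hF, norm_mul, Real.norm_of_nonneg (Real.exp_pos _).le]
    exact mul_le_mul (φ.norm_coe_le_norm _) (hfb a x) (Real.exp_pos _).le (norm_nonneg _)
  have hF_int (a : A) : Integrable (F a) m :=
    .of_bound (hF_meas a).aestronglyMeasurable _ (ae_of_all _ (hF_le a))
  have hruelle : ruelle f φ = fun x => ∑' a, F a x := funext (ruelle_eq_tsum f φ)
  refine ⟨fun x => (preimageEquiv x).summable_iff.1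
    (.of_norm_bounded (hb.mul_left ‖φ‖) fun a => hF_le a x), ?_, ?_⟩
  · rw [hruelle]
    exact .of_bound (Measurable.tsum hF_meas).aestronglyMeasurable _
      (ae_of_all _ fun x => tsum_of_norm_bounded (hb.mul_left ‖φ‖).hasSum fun a => hF_le a x)
  · have := isFiniteMeasure_dualMeasure m hb hfb
    rw [hruelle, integral_dualMeasure m hf hφ (φ.integrable _),
      integral_tsum_of_summable_integral_norm hF_int]
    refine .of_nonneg_of_le (fun a => integral_nonneg fun _ => norm_nonneg _) (fun a => ?_)
      ((hb.mul_left ‖φ‖).mul_left (m.real Set.univ))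
    calc ∫ x, ‖F a x‖ ∂m ≤ ∫ _, ‖φ‖ * b a ∂m :=
          integral_mono (hF_int a).norm (integrable_const _) (hF_le a)
      _ = m.real Set.univ * (‖φ‖ * b a) := by simp

end DualMeasure

namespace Potential

variable {A : Type*} [MeasurableSpace A] {g : Potential A}

namespace L1Bounded

lemma measurable_logEval [DiscreteMeasurableSpace A] (hg : g.L1Bounded) :
    Measurable g.logEval := by
  rw [funext hg.logEval_eq]
  exact measurable_const.add (Measurable.tsum fun n =>
    (Measurable.of_discrete (f := fun a => Real.log (g.factor n a))).comp (measurable_pi_apply n))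

variable [Nonempty A]

lemma isProbabilityMeasure_conformalMeasure (hg : g.L1Bounded) (hs : g.IsSummable) :
    IsProbabilityMeasure g.conformalMeasure :=
  isProbabilityMeasure_productMeasure (hg.isProbabilityVector_conformalWeight hs)

lemma bernoulliMeasure_mem_invariantMeasures (hg : g.L1Bounded) (hs : g.IsSummable) :
    g.bernoulliMeasure ∈ invariantMeasures A :=
  (hg.isProbabilityVector_bernoulliWeight hs).productMeasure_mem_invariantMeasures

variable [MeasurableSingletonClass A]

lemma partialEval_mul_conformalMeasure_cylinder (hg : g.L1Bounded) (hs : g.IsSummable) (n : ℕ)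
    (x : Seq A) :
    ENNReal.ofReal (g.partialEval n x) * g.conformalMeasure (cylinder (word n (shift x))) =
      ENNReal.ofReal (g.partialEigenvalue n) *
        g.conformalMeasure (cylinder (word (n + 1) x)) := by
  have hprob := hg.isProbabilityVector_conformalWeight hs
  rw [conformalMeasure, productMeasure_cylinder_word hprob, productMeasure_cylinder_word hprob,
    ← ENNReal.ofReal_mul (partialEval_pos n x).le,
    ← ENNReal.ofReal_mul (hg.partialEigenvalue_pos hs n).le]
  exact congrArg ENNReal.ofReal (hg.partialEval_mul_prod_conformalWeight hs n x)

lemma dualMeasure_conformalMeasure [Countable A] (hg : g.L1Bounded) (hs : g.IsSummable) :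
    dualMeasure g.logEval g.conformalMeasure =
      ENNReal.ofReal g.eigenvalue • g.conformalMeasure := by
  have := hg.isProbabilityMeasure_conformalMeasure hs
  have hexp : Tendsto (fun n => Real.exp (g.tailBound n)) atTop (𝓝 1) := by
    simpa using (tendsto_tailBound (g := g)).rexp
  have hexp_neg : Tendsto (fun n => Real.exp (-g.tailBound n)) atTop (𝓝 1) := by
    simpa using (tendsto_tailBound (g := g)).neg.rexp
  have hlim := hg.tendsto_partialEigenvalue hs
  refine eq_smul_of_cylinder_bounds ENNReal.ofReal_ne_top
    (a := fun n => ENNReal.ofReal (Real.exp (-g.tailBound n) * g.partialEigenvalue n))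
    (b := fun n => ENNReal.ofReal (Real.exp (g.tailBound n) * g.partialEigenvalue n))
    (ENNReal.tendsto_ofReal (by simpa using hexp_neg.mul hlim))
    (ENNReal.tendsto_ofReal (by simpa using hexp.mul hlim)) (fun n w => ?_) (fun n w => ?_)
  all_goals
    obtain ⟨x, rfl⟩ := word_surjective _ w
    rw [ENNReal.ofReal_mul (Real.exp_pos _).le, mul_assoc,
      ← hg.partialEval_mul_conformalMeasure_cylinder hs, ← mul_assoc,
      ← ENNReal.ofReal_mul (Real.exp_pos _).le]
  · refine le_dualMeasure_cylinder_word _ fun y hy => ?_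
    rw [hg.exp_logEval, ← partialEval_cons hy]
    exact hg.le_eval n _
  · refine dualMeasure_cylinder_word_le _ fun y hy => ?_
    rw [hg.exp_logEval, ← partialEval_cons hy]
    exact hg.eval_le n _

lemma dualMeasure_bernoulliMeasure [Countable A] (hg : g.L1Bounded) (hs : g.IsSummable) :
    dualMeasure g.logNormalized g.bernoulliMeasure = g.bernoulliMeasure := by
  have hprob := fun _ : ℕ => hg.isProbabilityVector_bernoulliWeight hs
  have := (hg.bernoulliMeasure_mem_invariantMeasures hs).1
  have hcyl (n : ℕ) (x : Seq A) :
      ENNReal.ofReal (g.bernoulliWeight (x 0)) *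
        g.bernoulliMeasure (cylinder (word n (shift x))) =
      1 * g.bernoulliMeasure (cylinder (word (n + 1) x)) := by
    rw [bernoulliMeasure, productMeasure_cylinder_word hprob, productMeasure_cylinder_word hprob,
      ← ENNReal.ofReal_mul (hg.bernoulliWeight_pos hs _).le, Finset.prod_range_succ', mul_comm,
      one_mul]
    rfl
  refine (eq_smul_of_cylinder_bounds ENNReal.one_ne_top (a := fun _ => 1) (b := fun _ => 1)
    tendsto_const_nhds tendsto_const_nhds (fun n w => ?_) (fun n w => ?_)).trans (one_smul _ _)
  all_goals obtain ⟨x, rfl⟩ := word_surjective _ w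
  all_goals rw [← hcyl]
  · refine le_dualMeasure_cylinder_word _ fun y _ => (hg.exp_logNormalized hs _).ge
  · refine dualMeasure_cylinder_word_le _ fun y _ => (hg.exp_logNormalized hs _).le

variable [TopologicalSpace A] [DiscreteTopology A] [BorelSpace A] [Countable A]

lemma isDualImage_logEval (hg : g.L1Bounded) (hs : g.IsSummable) :
    IsDualImage g.logEval g.conformalMeasure
      (ENNReal.ofReal g.eigenvalue • g.conformalMeasure) := by
  have := hg.isProbabilityMeasure_conformalMeasure hs
  rw [← hg.dualMeasure_conformalMeasure hs]
  refine isDualImage_dualMeasure _ hg.measurable_logEval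
    (b := fun a => Real.exp (g.tailBound 0) * (g.const * g.factor 0 a))
    (((hs : Summable (g.factor 0)).mul_left _).mul_left _) fun a x => ?_
  rw [hg.exp_logEval]
  simpa [partialEval] using hg.eval_le 0 (cons a x)

lemma isDualImage_logNormalized (hg : g.L1Bounded) (hs : g.IsSummable) :
    IsDualImage g.logNormalized g.bernoulliMeasure g.bernoulliMeasure := by
  have := (hg.bernoulliMeasure_mem_invariantMeasures hs).1
  have hdual := isDualImage_dualMeasure g.bernoulliMeasure (f := g.logNormalized)
    ((Measurable.of_discrete (f := fun a => Real.log (g.bernoulliWeight a))).comp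
      (measurable_pi_apply 0))
    (hg.isProbabilityVector_bernoulliWeight hs).hasSum.summable
    fun a x => (hg.exp_logNormalized hs (cons a x)).le
  rwa [hg.dualMeasure_bernoulliMeasure hs] at hdual

end L1Bounded
end Potential

/-! ### Pressure -/

section Pressure

variable {A : Type*} {f : Seq A → ℝ} {c : ℕ → ℝ}

lemma birkhoffProd_succ (f : Seq A → ℝ) (n : ℕ) (x : Seq A) :
    ∏ i ∈ Finset.range (n + 1), Real.exp (f (shift^[i] x)) =
      Real.exp (f x) * ∏ i ∈ Finset.range n, Real.exp (f (shift^[i] (shift x))) := by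
  simp only [Finset.prod_range_succ', Function.iterate_succ_apply, Function.iterate_zero_apply,
    mul_comm]

variable [MeasurableSpace A] (M : Measure (Seq A)) [IsProbabilityMeasure M]

lemma birkhoffProd_le
    (h : ∀ n x, ENNReal.ofReal (Real.exp (f x)) * M (cylinder (word n (shift x))) ≤
      ENNReal.ofReal (Real.exp (c n)) * M (cylinder (word (n + 1) x))) (n : ℕ) (x : Seq A) :
    ENNReal.ofReal (∏ i ∈ Finset.range n, Real.exp (f (shift^[i] x))) ≤
      ENNReal.ofReal (Real.exp (∑ j ∈ Finset.range n, c j)) * M (cylinder (word n x)) := by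
  induction n generalizing x with
  | zero => simp [cylinder]
  | succ n ih =>
    rw [birkhoffProd_succ, ENNReal.ofReal_mul (Real.exp_pos _).le, Finset.sum_range_succ,
      Real.exp_add, ENNReal.ofReal_mul (Real.exp_pos _).le, mul_assoc]
    refine (mul_le_mul_right (ih (shift x)) _).trans ?_
    rw [mul_left_comm]
    exact mul_le_mul_right (h n x) _

lemma le_birkhoffProd
    (h : ∀ n x, ENNReal.ofReal (Real.exp (c n)) * M (cylinder (word (n + 1) x)) ≤
      ENNReal.ofReal (Real.exp (f x)) * M (cylinder (word n (shift x)))) (n : ℕ) (x : Seq A) :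
    ENNReal.ofReal (Real.exp (∑ j ∈ Finset.range n, c j)) * M (cylinder (word n x)) ≤
      ENNReal.ofReal (∏ i ∈ Finset.range n, Real.exp (f (shift^[i] x))) := by
  induction n generalizing x with
  | zero => simp [cylinder]
  | succ n ih =>
    rw [birkhoffProd_succ, ENNReal.ofReal_mul (Real.exp_pos _).le, Finset.sum_range_succ,
      Real.exp_add, ENNReal.ofReal_mul (Real.exp_pos _).le, mul_assoc]
    refine le_trans ?_ (mul_le_mul_right (ih (shift x)) _)
    rw [mul_left_comm (ENNReal.ofReal (Real.exp (f x)))]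
    exact mul_le_mul_right (h n x) _

lemma ennrealLog_ofReal_exp_div (s : ℝ) (n : ℕ) :
    ENNReal.log (ENNReal.ofReal (Real.exp s)) / n = ((((n : ℝ)⁻¹ * s : ℝ)) : EReal) := by
  rw [ENNReal.log_ofReal_of_pos (Real.exp_pos _), Real.log_exp, ← EReal.coe_natCast,
    ← EReal.coe_div, div_eq_inv_mul]

variable [MeasurableSingletonClass A] [Countable A]

lemma partitionFunction_le
    (h : ∀ n x, ENNReal.ofReal (Real.exp (f x)) * M (cylinder (word n (shift x))) ≤
      ENNReal.ofReal (Real.exp (c n)) * M (cylinder (word (n + 1) x))) (n : ℕ) :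
    partitionFunction f n ≤ ENNReal.ofReal (Real.exp (∑ j ∈ Finset.range n, c j)) := by
  rw [← mul_one (ENNReal.ofReal _), ← measure_univ (μ := M), ← tsum_measure_cylinder_univ M n,
    ← ENNReal.tsum_mul_left]
  refine ENNReal.tsum_le_tsum fun w => iSup₂_le fun x hx => ?_
  rw [show w = word n x from funext fun i => (hx i).symm]
  exact birkhoffProd_le M h n x

variable [Nonempty A]

lemma le_partitionFunction
    (h : ∀ n x, ENNReal.ofReal (Real.exp (c n)) * M (cylinder (word (n + 1) x)) ≤
      ENNReal.ofReal (Real.exp (f x)) * M (cylinder (word n (shift x)))) (n : ℕ) :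
    ENNReal.ofReal (Real.exp (∑ j ∈ Finset.range n, c j)) ≤ partitionFunction f n := by
  rw [← mul_one (ENNReal.ofReal _), ← measure_univ (μ := M), ← tsum_measure_cylinder_univ M n,
    ← ENNReal.tsum_mul_left]
  refine ENNReal.tsum_le_tsum fun w => ?_
  obtain ⟨x, rfl⟩ := word_surjective n w
  exact (le_birkhoffProd M h n x).trans (le_iSup₂_of_le x (fun _ => rfl) le_rfl)

lemma hasPressure_of_cylinder_bounds {lower upper : ℕ → ℝ} {P : ℝ}
    (hlower : ∀ n x, ENNReal.ofReal (Real.exp (lower n)) * M (cylinder (word (n + 1) x)) ≤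
      ENNReal.ofReal (Real.exp (f x)) * M (cylinder (word n (shift x))))
    (hupper : ∀ n x, ENNReal.ofReal (Real.exp (f x)) * M (cylinder (word n (shift x))) ≤
      ENNReal.ofReal (Real.exp (upper n)) * M (cylinder (word (n + 1) x)))
    (hlower_lim : Tendsto lower atTop (𝓝 P)) (hupper_lim : Tendsto upper atTop (𝓝 P)) :
    HasPressure f P := by
  refine tendsto_of_tendsto_of_tendsto_of_le_of_le (EReal.tendsto_coe.2 hlower_lim.cesaro)
    (EReal.tendsto_coe.2 hupper_lim.cesaro) (fun n => ?_) (fun n => ?_)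
  all_goals dsimp only; rw [← ennrealLog_ofReal_exp_div]
  · exact EReal.div_le_div_right_of_nonneg n.cast_nonneg'
      (ENNReal.log_le_log (le_partitionFunction M hlower n))
  · exact EReal.div_le_div_right_of_nonneg n.cast_nonneg'
      (ENNReal.log_le_log (partitionFunction_le M hupper n))

end Pressure

lemma Potential.L1Bounded.hasPressure_logEval {A : Type*} {g : Potential A} [Nonempty A]
    [Countable A] (hg : g.L1Bounded) (hs : g.IsSummable) :
    HasPressure g.logEval (Real.log g.eigenvalue : ℝ) := by
  let _ : MeasurableSpace A := ⊤
  have := hg.isProbabilityMeasure_conformalMeasure hs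
  have hlog : Tendsto (fun n => Real.log (g.partialEigenvalue n)) atTop
      (𝓝 (Real.log g.eigenvalue)) :=
    (hg.tendsto_partialEigenvalue hs).log (hg.eigenvalue_pos hs).ne'
  have hexp (s : ℝ) (n : ℕ) (x : Seq A) :
      ENNReal.ofReal (Real.exp (s + Real.log (g.partialEigenvalue n))) *
        g.conformalMeasure (cylinder (word (n + 1) x)) =
      ENNReal.ofReal (Real.exp s * g.partialEval n x) *
        g.conformalMeasure (cylinder (word n (shift x))) := by
    rw [Real.exp_add, Real.exp_log (hg.partialEigenvalue_pos hs n),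
      ENNReal.ofReal_mul (Real.exp_pos _).le, mul_assoc,
      ← hg.partialEval_mul_conformalMeasure_cylinder hs, ← mul_assoc,
      ← ENNReal.ofReal_mul (Real.exp_pos _).le]
  refine hasPressure_of_cylinder_bounds g.conformalMeasure
    (lower := fun n => -g.tailBound n + Real.log (g.partialEigenvalue n))
    (upper := fun n => g.tailBound n + Real.log (g.partialEigenvalue n))
    (fun n x => ?_) (fun n x => ?_) (by simpa using tendsto_tailBound.neg.add hlog)
    (by simpa using tendsto_tailBound.add hlog)
  all_goals
    rw [hexp, hg.exp_logEval]
    gcongr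
  · exact hg.le_eval n x
  · exact hg.eval_le n x

/-! ### The Gibbs inequality along orbits -/

lemma sum_negMulLog_le {ι : Type*} [Fintype ι] {P q : ι → ℝ} (hP : ∀ i, 0 ≤ P i)
    (hq : ∀ i, 0 < q i) (hqP : ∑ i, q i ≤ ∑ i, P i) :
    ∑ i, Real.negMulLog (P i) ≤ ∑ i, P i * -Real.log (q i) := by
  have hterm (i : ι) : Real.negMulLog (P i) ≤ P i * -Real.log (q i) + (q i - P i) := by
    rcases (hP i).eq_or_lt with h | h
    · simpa [← h] using (hq i).le
    · have hlog := mul_le_mul_of_nonneg_left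
        (Real.log_le_sub_one_of_pos (div_pos (hq i) h)) h.le
      rw [Real.log_div (hq i).ne' h.ne', mul_sub_one, mul_div_cancel₀ _ h.ne'] at hlog
      rw [Real.negMulLog]
      linarith
  refine (Finset.sum_le_sum fun i _ => hterm i).trans ?_
  rw [Finset.sum_add_distrib, Finset.sum_sub_distrib]
  linarith

section BirkhoffSums

variable {X : Type*} [MeasurableSpace X] {m : Measure X} {T : X → X} {f : X → ℝ}

lemma integrable_birkhoffSum (hT : MeasurePreserving T m m) (hf : Integrable f m) (n : ℕ) :
    Integrable (birkhoffSum T f n) m :=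
  integrable_finsetSum _ fun i _ => (hT.iterate i).integrable_comp_of_integrable hf

lemma integral_comp_of_measurePreserving {Y : Type*} [MeasurableSpace Y] {ν : Measure Y}
    {S : X → Y} {φ : Y → ℝ} (hS : MeasurePreserving S m ν) (hφ : AEStronglyMeasurable φ ν) :
    ∫ x, φ (S x) ∂m = ∫ y, φ y ∂ν := by
  rw [← integral_map hS.aemeasurable (by rwa [hS.map_eq]), hS.map_eq]

lemma integral_birkhoffSum (hT : MeasurePreserving T m m) (hf : Integrable f m) (n : ℕ) :
    ∫ x, birkhoffSum T f n x ∂m = n * ∫ x, f x ∂m := by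
  simp only [birkhoffSum]
  rw [integral_finsetSum (f := fun i x => f (T^[i] x)) _
    fun i _ => (hT.iterate i).integrable_comp_of_integrable hf]
  simp only [integral_comp_of_measurePreserving (hT.iterate _) hf.aestronglyMeasurable,
    Finset.sum_const, Finset.card_range, nsmul_eq_mul]

end BirkhoffSums

section Itineraries

variable {X : Type*} {T : X → X} {k n : ℕ} {ξ : X → Fin k}

/-- The labels `ξ (x), ξ (T x), …, ξ (T^{n-1} x)` met by the first `n` points of an orbit. -/
def itinerary (T : X → X) (ξ : X → Fin k) (n : ℕ) (x : X) : Fin n → Fin k := fun i => ξ (T^[i] x)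

variable [MeasurableSpace X]

lemma measurable_itinerary (hT : Measurable T) (hξ : Measurable ξ) (n : ℕ) :
    Measurable (itinerary T ξ n) :=
  measurable_pi_lambda _ fun i => hξ.comp (hT.iterate i)

variable (m : Measure X)

lemma refinedEntropy_eq_sum_itinerary (T : X → X) (ξ : X → Fin k) (n : ℕ) :
    refinedEntropy m T ξ n = ∑ w, Real.negMulLog (m.real (itinerary T ξ n ⁻¹' {w})) := by
  refine Finset.sum_congr rfl fun w _ => ?_
  congr 2
  ext x
  simp [itinerary, funext_iff]

variable [IsProbabilityMeasure m]

lemma sum_measureReal_itinerary (hT : Measurable T) (hξ : Measurable ξ) (n : ℕ) :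
    ∑ w, m.real (itinerary T ξ n ⁻¹' {w}) = 1 := by
  rw [sum_measureReal_preimage_singleton _ fun w _ =>
    measurable_itinerary hT hξ n (measurableSet_singleton w)]
  simp

lemma refinedEntropy_le_integral_neg_log (hT : Measurable T) (hξ : Measurable ξ)
    {q : (Fin n → Fin k) → ℝ} (hq : ∀ w, 0 < q w) (hq1 : ∑ w, q w ≤ 1) :
    refinedEntropy m T ξ n ≤ ∫ x, -Real.log (q (itinerary T ξ n x)) ∂m := by
  have hitin := measurable_itinerary hT hξ n
  have := Measure.isProbabilityMeasure_map (μ := m) hitin.aemeasurable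
  rw [refinedEntropy_eq_sum_itinerary, ← integral_map (f := fun w => -Real.log (q w))
    hitin.aemeasurable (measurable_of_finite _).aestronglyMeasurable, integral_fintype .of_finite]
  simp only [smul_eq_mul, map_measureReal_apply hitin (measurableSet_singleton _)]
  exact sum_negMulLog_le (fun w => measureReal_nonneg) hq
    (hq1.trans_eq (sum_measureReal_itinerary m hT hξ n).symm)

end Itineraries

section Channel

variable {k : ℕ} {η : ℝ}

/-- The transition matrix of a noisy channel, which transmits a label faithfully with probability
`1 - η` and otherwise replaces it by a uniformly distributed one. -/
def channel (η : ℝ) (i j : Fin k) : ℝ := (if i = j then 1 - η else 0) + η / k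

/-- The transition matrix of `channel` used independently for each letter of a word. -/
def wordChannel (η : ℝ) {n : ℕ} (v u : Fin n → Fin k) : ℝ := ∏ i, channel η (v i) (u i)

/-- The distribution of the word received when `itinerary T ζ n y` is sent through `wordChannel`
and `y` has the distribution `ν`. -/
def receivedProb {X : Type*} [MeasurableSpace X] (ν : Measure X) (T : X → X) (ζ : X → Fin k)
    (η : ℝ) (n : ℕ) (u : Fin n → Fin k) : ℝ :=
  ∑ v, ν.real (itinerary T ζ n ⁻¹' {v}) * wordChannel η v u

lemma channel_pos (h0 : 0 < η) (h1 : η < 1) (i j : Fin k) : 0 < channel η i j := by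
  have hk : (0 : ℝ) < k := by exact_mod_cast i.pos
  rw [channel]
  split_ifs
  · linarith [div_pos h0 hk]
  · linarith [div_pos h0 hk]

lemma sum_channel (η : ℝ) (i : Fin k) : ∑ j, channel η i j = 1 := by
  have hk : (k : ℝ) ≠ 0 := by exact_mod_cast i.pos.ne'
  simp only [channel, Finset.sum_add_distrib, Finset.sum_ite_eq, Finset.mem_univ, if_true,
    Finset.sum_const, Finset.card_univ, Fintype.card_fin, nsmul_eq_mul, mul_div_cancel₀ _ hk,
    sub_add_cancel]

lemma neg_log_channel_self_le (h0 : 0 < η) (h1 : η < 1) (i : Fin k) :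
    -Real.log (channel η i i) ≤ -Real.log (1 - η) := by
  rw [channel, if_pos rfl]
  exact neg_le_neg (Real.log_le_log (by linarith) (by linarith [div_nonneg h0.le k.cast_nonneg]))

lemma neg_log_channel_of_ne {i j : Fin k} (hij : i ≠ j) :
    -Real.log (channel η i j) = -Real.log (η / k) := by
  rw [channel, if_neg hij, zero_add]

variable {n : ℕ}

lemma wordChannel_pos (h0 : 0 < η) (h1 : η < 1) (v u : Fin n → Fin k) : 0 < wordChannel η v u :=
  Finset.prod_pos fun i _ => channel_pos h0 h1 (v i) (u i)

lemma sum_wordChannel (η : ℝ) (v : Fin n → Fin k) : ∑ u, wordChannel η v u = 1 := by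
  simp only [wordChannel]
  rw [← Fintype.prod_sum fun i j => channel η (v i) j]
  exact Finset.prod_eq_one fun i _ => sum_channel η (v i)

variable {X : Type*} {T : X → X} {ξ ζ : X → Fin k}

lemma neg_log_wordChannel_itinerary (h0 : 0 < η) (h1 : η < 1) (n : ℕ) (x : X) :
    -Real.log (wordChannel η (itinerary T ζ n x) (itinerary T ξ n x)) =
      birkhoffSum T (fun y => -Real.log (channel η (ζ y) (ξ y))) n x := by
  rw [wordChannel, Real.log_prod fun i _ => (channel_pos h0 h1 _ _).ne', birkhoffSum,
    Finset.sum_neg_distrib, Finset.sum_range]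
  rfl

variable [MeasurableSpace X]

section Received

variable (ν : Measure X)

lemma sum_receivedProb [IsProbabilityMeasure ν] (hT : Measurable T) (hζ : Measurable ζ) (η : ℝ)
    (n : ℕ) :
    ∑ u, receivedProb ν T ζ η n u = 1 := by
  simp only [receivedProb]
  rw [Finset.sum_comm]
  simp only [← Finset.mul_sum, sum_wordChannel, mul_one, sum_measureReal_itinerary ν hT hζ]

lemma mul_wordChannel_le_receivedProb (h0 : 0 < η) (h1 : η < 1) (v u : Fin n → Fin k) :
    ν.real (itinerary T ζ n ⁻¹' {v}) * wordChannel η v u ≤ receivedProb ν T ζ η n u :=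
  Finset.single_le_sum (f := fun v => ν.real (itinerary T ζ n ⁻¹' {v}) * wordChannel η v u)
    (fun v _ => mul_nonneg measureReal_nonneg (wordChannel_pos h0 h1 v u).le) (Finset.mem_univ v)

end Received

variable (m : Measure X) [IsProbabilityMeasure m]

lemma integrable_neg_log_channel (η : ℝ) (hξ : Measurable ξ) (hζ : Measurable ζ) :
    Integrable (fun x => -Real.log (channel η (ζ x) (ξ x))) m := by
  have hpair : Measurable fun x => (ζ x, ξ x) := hζ.prodMk hξ
  have := Measure.isProbabilityMeasure_map (μ := m) hpair.aemeasurable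
  exact (Integrable.of_finite (μ := m.map fun x => (ζ x, ξ x))
    (f := fun z => -Real.log (channel η z.1 z.2))).comp_measurable hpair

lemma integral_neg_log_channel_le (h0 : 0 < η) (h1 : η < 1) (hξ : Measurable ξ)
    (hζ : Measurable ζ) :
    ∫ x, -Real.log (channel η (ζ x) (ξ x)) ∂m ≤
      -Real.log (1 - η) + m.real {x | ξ x ≠ ζ x} * -Real.log (η / k) := by
  have hne : MeasurableSet {x | ξ x ≠ ζ x} := (measurableSet_eq_fun hξ hζ).compl
  have hpoint (x : X) : -Real.log (channel η (ζ x) (ξ x)) ≤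
      -Real.log (1 - η) + {x | ξ x ≠ ζ x}.indicator (fun _ => -Real.log (η / k)) x := by
    by_cases h : ξ x = ζ x
    · simpa [h] using neg_log_channel_self_le h0 h1 (ζ x)
    · rw [neg_log_channel_of_ne fun h' => h h'.symm, Set.indicator_of_mem (show _ ≠ _ from h)]
      linarith [Real.log_nonpos (sub_nonneg.2 h1.le) (by linarith)]
  have hind : Integrable ({x | ξ x ≠ ζ x}.indicator fun _ => -Real.log (η / k)) m :=
    (integrable_const _).indicator hne
  refine (integral_mono (integrable_neg_log_channel m η hξ hζ)
    ((integrable_const _).add hind) hpoint).trans_eq ?_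
  rw [integral_add' (integrable_const _) hind, integral_indicator hne]
  simp

end Channel

section WordApproximation

variable {A : Type*} [MeasurableSpace A] (m : Measure (Seq A)) [IsFiniteMeasure m]

lemma exists_symmDiff_preimage_word_lt {s : Set (Seq A)} (hs : MeasurableSet s) {ε : ℝ≥0∞}
    (hε : 0 < ε) :
    ∃ N, ∀ n ≥ N, ∃ S : Set (Fin n → A), m (symmDiff (word n ⁻¹' S) s) < ε := by
  obtain ⟨t, ht, hts⟩ := exists_measure_symmDiff_lt_of_generateFrom_isSetRing (μ := m)
    isSetRing_measurableCylinders
    ⟨{Set.univ}, Set.countable_singleton _, by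
      simpa using univ_mem_measurableCylinders fun _ : ℕ => A, by simp⟩
    generateFrom_measurableCylinders.symm hs hε
  obtain ⟨N, hN⟩ := exists_preimage_word_of_mem_measurableCylinders ht
  refine ⟨N, fun n hn => ?_⟩
  obtain ⟨S, rfl⟩ := hN n hn
  exact ⟨S, hts⟩

lemma exists_label_of_word {k : ℕ} [NeZero k] {ξ : Seq A → Fin k} (hξ : Measurable ξ) {ε : ℝ}
    (hε : 0 < ε) :
    ∃ (n : ℕ) (F : (Fin n → A) → Fin k), m.real {x | ξ x ≠ F (word n x)} ≤ ε := by
  classical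
  choose N hN using fun j => exists_symmDiff_preimage_word_lt m (hξ (measurableSet_singleton j))
    (ε := ENNReal.ofReal ε / k)
    (ENNReal.div_pos (ENNReal.ofReal_pos.2 hε).ne' (ENNReal.natCast_ne_top k))
  set n := Finset.univ.sup N
  choose S hS using fun j => hN j n (Finset.le_sup (Finset.mem_univ j))
  let F : (Fin n → A) → Fin k := fun w => if h : ∃ j, w ∈ S j then h.choose else 0
  have hsub : {x | ξ x ≠ F (word n x)} ⊆ ⋃ j, symmDiff (word n ⁻¹' S j) (ξ ⁻¹' {j}) := by
    intro x hx
    by_contra hcon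
    have hiff (j : Fin k) : word n x ∈ S j ↔ ξ x = j := by
      have hj : x ∉ symmDiff (word n ⁻¹' S j) (ξ ⁻¹' {j}) := fun h => hcon (Set.mem_iUnion.2 ⟨j, h⟩)
      simp only [Set.mem_symmDiff, Set.mem_preimage, Set.mem_singleton_iff] at hj
      tauto
    have hex : ∃ j, word n x ∈ S j := ⟨ξ x, (hiff _).2 rfl⟩
    refine hx ?_
    simp only [F, dif_pos hex]
    exact (hiff _).1 hex.choose_spec
  refine ⟨n, F, ENNReal.toReal_le_of_le_ofReal hε.le ?_⟩
  calc m {x | ξ x ≠ F (word n x)}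
      ≤ ∑ j, m (symmDiff (word n ⁻¹' S j) (ξ ⁻¹' {j})) :=
        (measure_mono hsub).trans (measure_iUnion_fintype_le _ _)
    _ ≤ ∑ _j : Fin k, ENNReal.ofReal ε / k := Finset.sum_le_sum fun j _ => (hS j).le
    _ = k * (ENNReal.ofReal ε / k) := by simp
    _ ≤ ENNReal.ofReal ε := ENNReal.mul_div_le

end WordApproximation

section EntropyUpperBound

variable {A : Type*} {k M : ℕ} {η : ℝ}

lemma cylinder_word_subset_preimage_itinerary (F : (Fin M → A) → Fin k) (n : ℕ) (x : Seq A) :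
    cylinder (word (n + M) x) ⊆
      itinerary shift (F ∘ word M) n ⁻¹' {itinerary shift (F ∘ word M) n x} := by
  intro y hy
  rw [mem_cylinder_word] at hy
  refine funext fun i => congrArg F (word_eq_word_iff.2 fun l hl => ?_)
  rw [shift_iterate_apply, shift_iterate_apply]
  exact hy _ (by lia)

variable [MeasurableSpace A] [MeasurableSingletonClass A] {p : A → ℝ}

lemma mul_wordChannel_le_receivedProb_productMeasure (hp : IsProbabilityVector p) (h0 : 0 < η)
    (h1 : η < 1) (F : (Fin M → A) → Fin k) (n : ℕ) (u : Fin n → Fin k) (x : Seq A) :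
    (∏ i ∈ Finset.range (n + M), p (x i)) *
        wordChannel η (itinerary shift (F ∘ word M) n x) u ≤
      receivedProb (productMeasure fun _ => p) shift (F ∘ word M) η n u := by
  have := isProbabilityMeasure_productMeasure fun _ : ℕ => hp
  refine le_trans ?_ (mul_wordChannel_le_receivedProb _ h0 h1
    (itinerary shift (F ∘ word M) n x) u)
  refine mul_le_mul_of_nonneg_right (le_of_eq_of_le ?_ (measureReal_mono
    (cylinder_word_subset_preimage_itinerary F n x))) (wordChannel_pos h0 h1 _ u).le
  rw [measureReal_def, productMeasure_cylinder_word fun _ => hp,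
    ENNReal.toReal_ofReal (Finset.prod_nonneg fun i _ => hp.nonneg _)]

lemma neg_log_receivedProb_le (hp : IsProbabilityVector p) (hpos : ∀ a, 0 < p a) (h0 : 0 < η)
    (h1 : η < 1) (ξ : Seq A → Fin k) (F : (Fin M → A) → Fin k) (n : ℕ) (x : Seq A) :
    -Real.log (receivedProb (productMeasure fun _ => p) shift (F ∘ word M) η n
        (itinerary shift ξ n x)) ≤
      birkhoffSum shift (fun y => -Real.log (p (y 0))) (n + M) x +
        birkhoffSum shift (fun y => -Real.log (channel η (F (word M y)) (ξ y))) n x := by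
  have hprod : 0 < ∏ i ∈ Finset.range (n + M), p (x i) := Finset.prod_pos fun i _ => hpos _
  have hchannel := wordChannel_pos h0 h1 (itinerary shift (F ∘ word M) n x) (itinerary shift ξ n x)
  have hbirkhoff : -Real.log (∏ i ∈ Finset.range (n + M), p (x i)) =
      birkhoffSum shift (fun y => -Real.log (p (y 0))) (n + M) x := by
    rw [Real.log_prod fun i _ => (hpos _).ne', birkhoffSum, ← Finset.sum_neg_distrib]
    simp only [shift_iterate_apply, zero_add]
  have hlog := Real.log_le_log (mul_pos hprod hchannel)
    (mul_wordChannel_le_receivedProb_productMeasure hp h0 h1 F n (itinerary shift ξ n x) x)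
  rw [Real.log_mul hprod.ne' hchannel.ne'] at hlog
  have hword := neg_log_wordChannel_itinerary (T := shift) (ξ := ξ) (ζ := F ∘ word M) h0 h1 n x
  simp only [Function.comp_apply] at hword
  rw [← hbirkhoff, ← hword]
  linarith

variable [Countable A] {m : Measure (Seq A)} [IsProbabilityMeasure m]

lemma refinedEntropy_le (hm : MeasurePreserving shift m m) (hp : IsProbabilityVector p)
    (hpos : ∀ a, 0 < p a) (hint : Integrable (fun x : Seq A => -Real.log (p (x 0))) m)
    {ξ : Seq A → Fin k} (hξ : Measurable ξ) (F : (Fin M → A) → Fin k) (h0 : 0 < η) (h1 : η < 1)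
    (n : ℕ) :
    refinedEntropy m shift ξ n ≤ (n + M : ℕ) * (∫ x, -Real.log (p (x 0)) ∂m) +
      n * ∫ x, -Real.log (channel η (F (word M x)) (ξ x)) ∂m := by
  have := isProbabilityMeasure_productMeasure fun _ : ℕ => hp
  have hF : Measurable (F ∘ word M) := Measurable.of_discrete.comp (measurable_word M)
  obtain ⟨x₀⟩ : Nonempty (Seq A) := nonempty_of_isProbabilityMeasure m
  set q := receivedProb (productMeasure fun _ => p) shift (F ∘ word M) η n
  have hq (u : Fin n → Fin k) : 0 < q u :=
    (mul_pos (Finset.prod_pos fun i _ => hpos _) (wordChannel_pos h0 h1 _ u)).trans_le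
      (mul_wordChannel_le_receivedProb_productMeasure hp h0 h1 F n u x₀)
  have hq_int : Integrable (fun x => -Real.log (q (itinerary shift ξ n x))) m := by
    have hitin := measurable_itinerary measurable_shift hξ n
    have := Measure.isProbabilityMeasure_map (μ := m) hitin.aemeasurable
    exact (Integrable.of_finite (f := fun w => -Real.log (q w))).comp_measurable hitin
  have hchannel : Integrable (fun x => -Real.log (channel η (F (word M x)) (ξ x))) m :=
    integrable_neg_log_channel m η hξ hF
  refine (refinedEntropy_le_integral_neg_log m measurable_shift hξ hq
    (sum_receivedProb _ measurable_shift hF η n).le).trans ?_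
  rw [← integral_birkhoffSum hm hint, ← integral_birkhoffSum hm hchannel,
    ← integral_add (integrable_birkhoffSum hm hint _) (integrable_birkhoffSum hm hchannel _)]
  exact integral_mono hq_int
    ((integrable_birkhoffSum hm hint _).add (integrable_birkhoffSum hm hchannel _))
    (neg_log_receivedProb_le hp hpos h0 h1 ξ F n)

lemma limsup_div_le {u : ℕ → ℝ} {a b : ℝ} (h : ∀ n : ℕ, u n ≤ n * a + b) :
    limsup (fun n : ℕ => ((u n / n : ℝ) : EReal)) atTop ≤ a := by
  have hlim : Tendsto (fun n : ℕ => a + b / n) atTop (𝓝 a) := by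
    simpa using (tendsto_const_div_atTop_nhds_zero_nat b).const_add a
  rw [← (EReal.tendsto_coe.2 hlim).limsup_eq]
  refine limsup_le_limsup ((eventually_gt_atTop 0).mono fun n hn => ?_)
  have hn' : (0 : ℝ) < n := by exact_mod_cast hn
  rw [EReal.coe_le_coe_iff, div_le_iff₀ hn', add_mul, div_mul_cancel₀ _ hn'.ne', mul_comm a]
  exact h n

lemma limsup_refinedEntropy_le (hm : MeasurePreserving shift m m) (hp : IsProbabilityVector p)
    (hpos : ∀ a, 0 < p a) (hint : Integrable (fun x : Seq A => -Real.log (p (x 0))) m)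
    {ξ : Seq A → Fin k} (hξ : Measurable ξ) (h0 : 0 < η) (h1 : η < 1) :
    limsup (fun n : ℕ => ((refinedEntropy m shift ξ n / n : ℝ) : EReal)) atTop ≤
      ((∫ x, -Real.log (p (x 0)) ∂m) + (-Real.log (1 - η) + k * Real.negMulLog (η / k)) : ℝ) := by
  obtain ⟨x₀⟩ : Nonempty (Seq A) := nonempty_of_isProbabilityMeasure m
  have hk : 1 ≤ k := (ξ x₀).pos
  have : NeZero k := ⟨by lia⟩
  have hk' : (1 : ℝ) ≤ k := by exact_mod_cast hk
  obtain ⟨M, F, hF⟩ := exists_label_of_word m hξ h0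
  have hloss : ∫ x, -Real.log (channel η (F (word M x)) (ξ x)) ∂m ≤
      -Real.log (1 - η) + k * Real.negMulLog (η / k) := by
    refine (integral_neg_log_channel_le m (ζ := F ∘ word M) h0 h1 hξ
      (Measurable.of_discrete.comp (measurable_word M))).trans ?_
    have hlog : 0 ≤ -Real.log (η / k) :=
      neg_nonneg.2 (Real.log_nonpos (by positivity)
        (div_le_one_of_le₀ (h1.le.trans hk') k.cast_nonneg))
    have hmul : k * Real.negMulLog (η / k) = η * -Real.log (η / k) := by
      rw [Real.negMulLog]
      field_simp
    rw [hmul]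
    gcongr
    exact hF
  refine limsup_div_le (b := M * ∫ x, -Real.log (p (x 0)) ∂m) fun n => ?_
  have h := refinedEntropy_le hm hp hpos hint hξ F h0 h1 n
  have hn := mul_le_mul_of_nonneg_left hloss n.cast_nonneg
  push_cast at h
  linarith

lemma ksEntropy_le (hm : MeasurePreserving shift m m) (hp : IsProbabilityVector p)
    (hpos : ∀ a, 0 < p a) (hint : Integrable (fun x : Seq A => -Real.log (p (x 0))) m) :
    ksEntropy m shift ≤ ((∫ x, -Real.log (p (x 0)) ∂m : ℝ) : EReal) := by
  refine iSup_le fun k => iSup₂_le fun ξ hξ => ?_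
  have hcont : ContinuousAt (fun η : ℝ => (∫ x, -Real.log (p (x 0)) ∂m) +
      (-Real.log (1 - η) + k * Real.negMulLog (η / k))) 0 := by
    refine continuousAt_const.add (ContinuousAt.add ?_ ?_)
    · exact (ContinuousAt.log (by fun_prop) (by simp)).neg
    · exact (continuous_const.mul
        (Real.continuous_negMulLog.comp (continuous_id.div_const _))).continuousAt
  have hlim := hcont.tendsto.mono_left (nhdsWithin_le_nhds (s := Set.Ioi 0))
  simp only [sub_zero, Real.log_one, neg_zero, zero_div, Real.negMulLog_zero, mul_zero,
    add_zero] at hlim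
  refine ge_of_tendsto (EReal.tendsto_coe.2 hlim) ?_
  filter_upwards [Ioo_mem_nhdsGT (zero_lt_one' ℝ)] with η hη
  exact limsup_refinedEntropy_le hm hp hpos hint hξ hη.1 hη.2

end EntropyUpperBound

/-! ### The entropy of a Bernoulli measure -/

lemma sum_negMulLog_prod {ι : Type*} [Fintype ι] {r : ι → ℝ} (hr : ∑ j, r j = 1) (n : ℕ) :
    ∑ w : Fin n → ι, Real.negMulLog (∏ i, r (w i)) = n * ∑ j, Real.negMulLog (r j) := by
  have hone (n : ℕ) : ∑ w : Fin n → ι, ∏ i, r (w i) = 1 := by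
    classical
    rw [← Fintype.prod_sum fun (_ : Fin n) j => r j]
    simp [hr]
  induction n with
  | zero => simp
  | succ n ih =>
    rw [← (Fin.consEquiv fun _ => ι).sum_comp, Fintype.sum_prod_type]
    simp only [Fin.consEquiv_apply, Fin.prod_univ_succ, Fin.cons_zero, Fin.cons_succ,
      Real.negMulLog_mul, Finset.sum_add_distrib, ← Finset.mul_sum, ← Finset.sum_mul, hone, ih,
      hr]
    push_cast
    ring

section BernoulliEntropy

variable {A : Type*} [MeasurableSpace A]

lemma refinedEntropy_infinitePi (ν : Measure A) [IsProbabilityMeasure ν] {k : ℕ} [NeZero k]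
    {c : A → Fin k} (hc : Measurable c) (n : ℕ) :
    refinedEntropy (Measure.infinitePi fun _ : ℕ => ν) shift (fun x => c (x 0)) n =
      n * ∑ j, Real.negMulLog (ν.real (c ⁻¹' {j})) := by
  have hr : ∑ j, ν.real (c ⁻¹' {j}) = 1 := by
    rw [sum_measureReal_preimage_singleton _ fun j _ => hc (measurableSet_singleton j)]
    simp
  rw [refinedEntropy_eq_sum_itinerary, ← sum_negMulLog_prod hr]
  refine Finset.sum_congr rfl fun w _ => congrArg _ ?_
  obtain ⟨z, rfl⟩ := word_surjective n w
  have hpi : itinerary shift (fun x : Seq A => c (x 0)) n ⁻¹' {word n z} =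
      Set.pi (Finset.range n) fun i => c ⁻¹' {z i} := by
    ext x
    simp [itinerary, word, funext_iff, Fin.forall_iff, shift_iterate_apply]
  rw [hpi, measureReal_def, Measure.infinitePi_pi _ fun _ _ => hc (measurableSet_singleton _),
    ENNReal.toReal_prod, Finset.prod_range]
  rfl

lemma sum_negMulLog_le_ksEntropy_infinitePi (ν : Measure A) [IsProbabilityMeasure ν] {k : ℕ}
    [NeZero k] {c : A → Fin k} (hc : Measurable c) :
    ((∑ j, Real.negMulLog (ν.real (c ⁻¹' {j})) : ℝ) : EReal) ≤
      ksEntropy (Measure.infinitePi fun _ : ℕ => ν) shift := by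
  refine le_trans (le_of_eq (Tendsto.limsup_eq ?_).symm)
    (le_iSup_of_le k (le_iSup₂_of_le (fun x => c (x 0)) (hc.comp (measurable_pi_apply 0)) le_rfl))
  refine tendsto_const_nhds.congr' ((eventually_ne_atTop 0).mono fun n hn => ?_)
  dsimp only
  rw [refinedEntropy_infinitePi ν hc, mul_div_cancel_left₀ _ (by exact_mod_cast hn)]

open scoped Classical in
/-- The partition of the alphabet into the singletons of `S` and the complement of `S`. -/
def letterLabel (S : Finset A) (a : A) : Fin (S.card + 1) :=
  if h : a ∈ S then (S.equivFin ⟨a, h⟩).castSucc else Fin.last _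

omit [MeasurableSpace A] in
lemma letterLabel_preimage_castSucc (S : Finset A) (j : Fin S.card) :
    letterLabel S ⁻¹' {j.castSucc} = {(S.equivFin.symm j : A)} := by
  ext a
  simp only [letterLabel, Set.mem_preimage, Set.mem_singleton_iff]
  split_ifs with h
  · rw [Fin.castSucc_inj, ← Equiv.eq_symm_apply, Subtype.ext_iff]
  · refine iff_of_false (Fin.castSucc_lt_last j).ne' ?_
    rintro rfl
    exact h (S.equivFin.symm j).2

variable [MeasurableSingletonClass A] [Countable A]

lemma sum_finset_negMulLog_le_ksEntropy_infinitePi (ν : Measure A) [IsProbabilityMeasure ν]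
    (S : Finset A) :
    ((∑ a ∈ S, Real.negMulLog (ν.real {a}) : ℝ) : EReal) ≤
      ksEntropy (Measure.infinitePi fun _ : ℕ => ν) shift := by
  refine (EReal.coe_le_coe_iff.2 ?_).trans
    (sum_negMulLog_le_ksEntropy_infinitePi ν (Measurable.of_discrete (f := letterLabel S)))
  rw [Fin.sum_univ_castSucc]
  refine le_add_of_le_of_nonneg (le_of_eq ?_)
    (Real.negMulLog_nonneg measureReal_nonneg measureReal_le_one)
  simp only [letterLabel_preimage_castSucc]
  rw [S.equivFin.symm.sum_comp fun a : S => Real.negMulLog (ν.real {(a : A)}),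
    Finset.sum_coe_sort S fun a => Real.negMulLog (ν.real {a})]

lemma lintegral_neg_log_productMeasure {p : A → ℝ} (hp : IsProbabilityVector p) :
    ∫⁻ x, ENNReal.ofReal (-Real.log (p (x 0))) ∂productMeasure (fun _ => p) =
      ∑' a, ENNReal.ofReal (Real.negMulLog (p a)) := by
  rw [(measurePreserving_eval_productMeasure (fun _ => hp) 0).lintegral_comp
    (f := fun a => ENNReal.ofReal (-Real.log (p a))) .of_discrete, lintegral_countable']
  refine tsum_congr fun a => ?_
  rw [letterMeasure_singleton, mul_comm, ← ENNReal.ofReal_mul (hp.nonneg a), Real.negMulLog]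
  congr 1
  ring

lemma lintegral_neg_log_le_ksEntropy {p : A → ℝ} (hp : IsProbabilityVector p) :
    ((∫⁻ x, ENNReal.ofReal (-Real.log (p (x 0))) ∂productMeasure (fun _ => p) : ℝ≥0∞) : EReal) ≤
      ksEntropy (productMeasure fun _ => p) shift := by
  have := hp.isProbabilityMeasure_letterMeasure
  have hfinite := sum_finset_negMulLog_le_ksEntropy_infinitePi (letterMeasure p)
  have hweight (a : A) : (letterMeasure p).real {a} = p a := by
    rw [measureReal_def, letterMeasure_singleton, ENNReal.toReal_ofReal (hp.nonneg a)]
  simp only [hweight] at hfinite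
  have hnonneg : 0 ≤ ksEntropy (Measure.infinitePi fun _ : ℕ => letterMeasure p) shift := by
    simpa using hfinite ∅
  rw [lintegral_neg_log_productMeasure hp, productMeasure,
    ← EReal.coe_toENNReal hnonneg, EReal.coe_ennreal_le_coe_ennreal_iff,
    ENNReal.tsum_eq_iSup_sum]
  refine iSup_le fun S => ?_
  rw [← ENNReal.ofReal_sum_of_nonneg fun a _ => Real.negMulLog_nonneg (hp.nonneg a) (hp.le_one a)]
  simpa using EReal.toENNReal_le_toENNReal (hfinite S)

lemma ksEntropy_productMeasure {p : A → ℝ} (hp : IsProbabilityVector p) (hpos : ∀ a, 0 < p a) :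
    ksEntropy (productMeasure fun _ => p) shift =
      ((∫⁻ x, ENNReal.ofReal (-Real.log (p (x 0))) ∂productMeasure fun _ => p : ℝ≥0∞) :
        EReal) := by
  refine le_antisymm ?_ (lintegral_neg_log_le_ksEntropy hp)
  obtain ⟨_, hinv⟩ := hp.productMeasure_mem_invariantMeasures
  have hmeas : Measurable fun x : Seq A => -Real.log (p (x 0)) :=
    (Measurable.of_discrete (f := fun a => -Real.log (p a))).comp (measurable_pi_apply 0)
  have hnonneg : 0 ≤ fun x : Seq A => -Real.log (p (x 0)) :=
    fun x => neg_nonneg.2 (Real.log_nonpos (hp.nonneg _) (hp.le_one _))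
  by_cases hfin : ∫⁻ x, ENNReal.ofReal (-Real.log (p (x 0))) ∂productMeasure (fun _ => p) = ∞
  · simp [hfin]
  · have hint := (lintegral_ofReal_ne_top_iff_integrable hmeas.aestronglyMeasurable
      (ae_of_all _ hnonneg)).1 hfin
    refine (ksEntropy_le hinv hp hpos hint).trans_eq ?_
    rw [← ofReal_integral_eq_lintegral_ofReal hint (ae_of_all _ hnonneg),
      EReal.coe_ennreal_ofReal, max_eq_left (integral_nonneg hnonneg)]

end BernoulliEntropy

/-! ### The integral of the potential -/

section ExtendedIntegral

lemma coe_sub_coe_sub (c : ℝ) (x : EReal) : (c : EReal) - ((c : EReal) - x) = x := by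
  induction x with
  | bot => simp
  | coe r => rw [← EReal.coe_sub, ← EReal.coe_sub, sub_sub_cancel]
  | top => simp

variable {X : Type*} [MeasurableSpace X] {m : Measure X} {b f : X → ℝ}

lemma extIntegral_eq_integral (hf : Integrable f m) :
    extIntegral m f = ((∫ x, f x ∂m : ℝ) : EReal) := by
  have hneg : ∫⁻ x, ENNReal.ofReal (-f x) ∂m ≠ ∞ := hf.neg.lintegral_lt_top.ne
  rw [extIntegral, integral_eq_lintegral_pos_part_sub_lintegral_neg_part hf, EReal.coe_sub,
    EReal.coe_ennreal_toReal hf.lintegral_lt_top.ne, EReal.coe_ennreal_toReal hneg]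

lemma extIntegral_add_of_nonpos (hb : Integrable b m) (hf : Measurable f) (hf0 : f ≤ 0) :
    extIntegral m (fun x => b x + f x) =
      ((∫ x, b x ∂m : ℝ) : EReal) - ((∫⁻ x, ENNReal.ofReal (-f x) ∂m : ℝ≥0∞) : EReal) := by
  have hnonneg : 0 ≤ fun x => -f x := fun x => neg_nonneg.2 (hf0 x)
  by_cases hfin : ∫⁻ x, ENNReal.ofReal (-f x) ∂m = ∞
  · have hneg : ∫⁻ x, ENNReal.ofReal (-(b x + f x)) ∂m = ∞ := by
      have hle : ∫⁻ x, ENNReal.ofReal (-f x) ∂m ≤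
          ∫⁻ x, ENNReal.ofReal (b x) ∂m + ∫⁻ x, ENNReal.ofReal (-(b x + f x)) ∂m := by
        rw [← lintegral_add_left' hb.aemeasurable.ennreal_ofReal]
        refine lintegral_mono fun x => le_trans (ENNReal.ofReal_le_ofReal ?_) ENNReal.ofReal_add_le
        linarith
      rw [hfin, top_le_iff, ENNReal.add_eq_top] at hle
      exact hle.resolve_left hb.lintegral_lt_top.ne
    rw [extIntegral, hneg, hfin, EReal.coe_ennreal_top, EReal.sub_top, EReal.sub_top]
  · have hint : Integrable (fun x => -f x) m :=
      (lintegral_ofReal_ne_top_iff_integrable hf.neg.aestronglyMeasurable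
        (ae_of_all _ hnonneg)).1 hfin
    have hsum : Integrable (fun x => b x + f x) m := by
      simpa only [Pi.sub_def, sub_neg_eq_add] using hb.sub hint
    rw [extIntegral_eq_integral hsum,
      ← ofReal_integral_eq_lintegral_ofReal hint (ae_of_all _ hnonneg), EReal.coe_ennreal_ofReal,
      max_eq_left (integral_nonneg hnonneg), ← EReal.coe_sub, ← integral_sub hb hint]
    simp only [sub_neg_eq_add]

end ExtendedIntegral

namespace Potential

variable {A : Type*} {g : Potential A}

/-- The difference between `log g` and the function of the first letter which agrees with `log g`
on the constant sequences. It is a sum of coboundaries `f ∘ T^k - f`, hence the name. -/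
def coboundary (g : Potential A) (x : Seq A) : ℝ := g.logEval x - g.logEval fun _ => x 0

lemma measurable_log_bernoulliWeight [MeasurableSpace A] [DiscreteMeasurableSpace A] :
    Measurable fun x : Seq A => Real.log (g.bernoulliWeight (x 0)) :=
  (Measurable.of_discrete (f := fun a => Real.log (g.bernoulliWeight a))).comp
    (measurable_pi_apply 0)

namespace L1Bounded

lemma coboundary_eq_tsum (hg : g.L1Bounded) (x : Seq A) :
    g.coboundary x = ∑' k, (Real.log (g.factor (k + 1) (x (k + 1))) -
      Real.log (g.factor (k + 1) (x 0))) := by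
  have hx := hg.summable_log_factor x
  have hx0 := hg.summable_log_factor fun _ => x 0
  rw [coboundary, hg.logEval_eq, hg.logEval_eq, add_sub_add_left_eq_sub, ← hx.tsum_sub hx0,
    (hx.sub hx0).tsum_eq_zero_add, sub_self, zero_add]

lemma norm_log_factor_sub_log_factor_le (hg : g.L1Bounded) (k : ℕ) (a b : A) :
    ‖Real.log (g.factor (k + 1) a) - Real.log (g.factor (k + 1) b)‖ ≤ 2 * g.logBound k := by
  rw [two_mul]
  exact (norm_sub_le _ _).trans (add_le_add (hg.abs_log_factor_le k a) (hg.abs_log_factor_le k b))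

lemma norm_coboundary_le (hg : g.L1Bounded) (x : Seq A) :
    ‖g.coboundary x‖ ≤ ∑' k, 2 * g.logBound k := by
  rw [hg.coboundary_eq_tsum]
  exact tsum_of_norm_bounded (hg.summable_logBound.mul_left 2).hasSum
    fun k => hg.norm_log_factor_sub_log_factor_le k _ _

variable [MeasurableSpace A] [DiscreteMeasurableSpace A] {m : Measure (Seq A)}

lemma integrable_coboundary (hg : g.L1Bounded) [IsFiniteMeasure m] : Integrable g.coboundary m :=
  .of_bound (hg.measurable_logEval.sub (hg.measurable_logEval.comp
    (measurable_pi_lambda _ fun _ => measurable_pi_apply 0))).aestronglyMeasurable _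
    (ae_of_all _ hg.norm_coboundary_le)

lemma integrable_log_factor (hg : g.L1Bounded) [IsFiniteMeasure m] (k i : ℕ) :
    Integrable (fun x => Real.log (g.factor (k + 1) (x i))) m :=
  .of_bound ((Measurable.of_discrete (f := fun a => Real.log (g.factor (k + 1) a))).comp
    (measurable_pi_apply i)).aestronglyMeasurable (g.logBound k)
    (ae_of_all _ fun _ => hg.abs_log_factor_le k _)

lemma integral_coboundary (hg : g.L1Bounded) [IsProbabilityMeasure m]
    (hm : MeasurePreserving shift m m) : ∫ x, g.coboundary x ∂m = 0 := by
  have hint (k : ℕ) := (hg.integrable_log_factor (m := m) k (k + 1)).sub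
    (hg.integrable_log_factor k 0)
  simp only [hg.coboundary_eq_tsum]
  refine (integral_tsum_of_summable_integral_norm hint ?_).symm.trans
    ((tsum_congr fun k => ?_).trans tsum_zero)
  · refine .of_nonneg_of_le (fun k => integral_nonneg fun _ => norm_nonneg _) (fun k => ?_)
      (hg.summable_logBound.mul_left 2)
    exact (integral_mono (hint k).norm (integrable_const (2 * g.logBound k)) fun x =>
      hg.norm_log_factor_sub_log_factor_le k _ _).trans_eq (by simp)
  · have hshift := integral_comp_of_measurePreserving (hm.iterate (k + 1))
      (hg.integrable_log_factor k 0).aestronglyMeasurable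
    simp only [shift_iterate_apply, zero_add] at hshift
    exact (integral_sub (hg.integrable_log_factor k _) (hg.integrable_log_factor k 0)).trans
      (sub_eq_zero.2 hshift)

lemma integrable_const_add_coboundary (hg : g.L1Bounded) [IsFiniteMeasure m] (c : ℝ) :
    Integrable (fun x => c + g.coboundary x) m :=
  (integrable_const c).add hg.integrable_coboundary

lemma integral_const_add_coboundary (hg : g.L1Bounded) [IsProbabilityMeasure m]
    (hm : MeasurePreserving shift m m) (c : ℝ) : ∫ x, (c + g.coboundary x) ∂m = c := by
  rw [integral_add (integrable_const c) hg.integrable_coboundary, hg.integral_coboundary hm]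
  simp

omit [MeasurableSpace A] [DiscreteMeasurableSpace A]
variable [Nonempty A]

lemma logEval_eq_add_coboundary (hg : g.L1Bounded) (hs : g.IsSummable) (x : Seq A) :
    g.logEval x =
      Real.log g.eigenvalue + g.coboundary x + Real.log (g.bernoulliWeight (x 0)) := by
  rw [bernoulliWeight_eq, Real.log_div (hg.eval_pos _).ne' (hg.eigenvalue_pos hs).ne', coboundary,
    logEval, logEval]
  ring

lemma log_bernoulliWeight_nonpos (hg : g.L1Bounded) (hs : g.IsSummable) (a : A) :
    Real.log (g.bernoulliWeight a) ≤ 0 :=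
  Real.log_nonpos (hg.bernoulliWeight_pos hs a).le
    ((hg.isProbabilityVector_bernoulliWeight hs).le_one a)

variable [MeasurableSpace A]

lemma lintegral_logEval_ne_top (hg : g.L1Bounded) (hs : g.IsSummable) (m : Measure (Seq A))
    [IsFiniteMeasure m] : ∫⁻ x, ENNReal.ofReal (g.logEval x) ∂m ≠ ⊤ := by
  have hle (x : Seq A) : g.logEval x ≤ Real.log g.eigenvalue + ∑' k, 2 * g.logBound k := by
    rw [hg.logEval_eq_add_coboundary hs]
    linarith [hg.log_bernoulliWeight_nonpos hs (x 0), (le_abs_self _).trans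
      (hg.norm_coboundary_le x)]
  exact ((lintegral_mono fun x => ENNReal.ofReal_le_ofReal (hle x)).trans_lt
    (lintegral_const_lt_top ENNReal.ofReal_ne_top)).ne

variable [DiscreteMeasurableSpace A] {m : Measure (Seq A)}

lemma extIntegral_logEval (hg : g.L1Bounded) (hs : g.IsSummable) [IsProbabilityMeasure m]
    (hm : MeasurePreserving shift m m) :
    extIntegral m g.logEval = (Real.log g.eigenvalue : EReal) -
      ((∫⁻ x, ENNReal.ofReal (-Real.log (g.bernoulliWeight (x 0))) ∂m : ℝ≥0∞) : EReal) := by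
  rw [funext (hg.logEval_eq_add_coboundary hs), extIntegral_add_of_nonpos
      (hg.integrable_const_add_coboundary _)
      measurable_log_bernoulliWeight fun x => hg.log_bernoulliWeight_nonpos hs (x 0),
    hg.integral_const_add_coboundary hm]

lemma integrable_logEval (hg : g.L1Bounded) (hs : g.IsSummable) [IsFiniteMeasure m]
    (hint : Integrable (fun x => -Real.log (g.bernoulliWeight (x 0))) m) :
    Integrable g.logEval m := by
  rw [funext (hg.logEval_eq_add_coboundary hs)]
  simpa only [Pi.sub_def, sub_neg_eq_add] using
    (hg.integrable_const_add_coboundary (Real.log g.eigenvalue)).sub hint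

lemma integral_logEval (hg : g.L1Bounded) (hs : g.IsSummable) [IsProbabilityMeasure m]
    (hm : MeasurePreserving shift m m)
    (hint : Integrable (fun x => -Real.log (g.bernoulliWeight (x 0))) m) :
    ∫ x, g.logEval x ∂m =
      Real.log g.eigenvalue - ∫ x, -Real.log (g.bernoulliWeight (x 0)) ∂m := by
  rw [← hg.integral_const_add_coboundary hm (Real.log g.eigenvalue),
    ← integral_sub (hg.integrable_const_add_coboundary _) hint]
  simp only [hg.logEval_eq_add_coboundary hs, sub_neg_eq_add]

variable [Countable A]

lemma ksEntropy_bernoulliMeasure (hg : g.L1Bounded) (hs : g.IsSummable) :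
    ksEntropy g.bernoulliMeasure shift =
      ((∫⁻ x, ENNReal.ofReal (-Real.log (g.bernoulliWeight (x 0))) ∂g.bernoulliMeasure : ℝ≥0∞) :
        EReal) :=
  ksEntropy_productMeasure (hg.isProbabilityVector_bernoulliWeight hs) (hg.bernoulliWeight_pos hs)

lemma ksEntropy_bernoulliMeasure_eq_sub (hg : g.L1Bounded) (hs : g.IsSummable) :
    ksEntropy g.bernoulliMeasure shift =
      (Real.log g.eigenvalue : EReal) - extIntegral g.bernoulliMeasure g.logEval := by
  obtain ⟨_, hm⟩ := hg.bernoulliMeasure_mem_invariantMeasures hs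
  rw [hg.extIntegral_logEval hs hm, ← hg.ksEntropy_bernoulliMeasure hs, coe_sub_coe_sub]

lemma integrable_logEval_of_ksEntropy_ne_top (hg : g.L1Bounded) (hs : g.IsSummable)
    (hfin : ksEntropy g.bernoulliMeasure shift ≠ ⊤) : Integrable g.logEval g.bernoulliMeasure := by
  have := (hg.bernoulliMeasure_mem_invariantMeasures hs).1
  rw [hg.ksEntropy_bernoulliMeasure hs, Ne, EReal.coe_ennreal_eq_top_iff] at hfin
  exact hg.integrable_logEval hs ((lintegral_ofReal_ne_top_iff_integrable
    measurable_log_bernoulliWeight.neg.aestronglyMeasurable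
    (ae_of_all _ fun _ => neg_nonneg.2 (hg.log_bernoulliWeight_nonpos hs _))).1 hfin)

lemma ksEntropy_add_integral_logEval (hg : g.L1Bounded) (hs : g.IsSummable)
    (hint : Integrable g.logEval g.bernoulliMeasure) :
    ksEntropy g.bernoulliMeasure shift + ((∫ x, g.logEval x ∂g.bernoulliMeasure : ℝ) : EReal) =
      (Real.log g.eigenvalue : ℝ) := by
  rw [hg.ksEntropy_bernoulliMeasure_eq_sub hs, extIntegral_eq_integral hint, ← EReal.coe_sub,
    ← EReal.coe_add, sub_add_cancel]

end L1Bounded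

section FiniteAlphabet

variable [Finite A] [MeasurableSpace A] [DiscreteMeasurableSpace A]

lemma integrable_neg_log_bernoulliWeight (g : Potential A) (m : Measure (Seq A))
    [IsFiniteMeasure m] : Integrable (fun x => -Real.log (g.bernoulliWeight (x 0))) m := by
  have h : Integrable (fun a => -Real.log (g.bernoulliWeight a)) (m.map fun x => x 0) := .of_finite
  exact h.comp_measurable (measurable_pi_apply 0)

variable [Nonempty A]

lemma L1Bounded.ksEntropy_bernoulliMeasure_ne_top (hg : g.L1Bounded) (hs : g.IsSummable) :
    ksEntropy g.bernoulliMeasure shift ≠ ⊤ := by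
  have := (hg.bernoulliMeasure_mem_invariantMeasures hs).1
  rw [hg.ksEntropy_bernoulliMeasure hs, Ne, EReal.coe_ennreal_eq_top_iff]
  exact (g.integrable_neg_log_bernoulliWeight _).lintegral_lt_top.ne

lemma L1Bounded.ksEntropy_add_integral_logEval_le (hg : g.L1Bounded) (hs : g.IsSummable)
    {m : Measure (Seq A)} [IsProbabilityMeasure m] (hm : MeasurePreserving shift m m) :
    ksEntropy m shift + ((∫ x, g.logEval x ∂m : ℝ) : EReal) ≤ (Real.log g.eigenvalue : ℝ) := by
  have hint := g.integrable_neg_log_bernoulliWeight m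
  refine (add_le_add_left (ksEntropy_le hm (hg.isProbabilityVector_bernoulliWeight hs)
    (hg.bernoulliWeight_pos hs) hint) _).trans_eq ?_
  rw [← EReal.coe_add, hg.integral_logEval hs hm hint, add_sub_cancel]

lemma L1Bounded.isEquilibriumState_bernoulliMeasure (hg : g.L1Bounded) (hs : g.IsSummable) :
    IsEquilibriumState g.logEval g.bernoulliMeasure := by
  have hmem := hg.bernoulliMeasure_mem_invariantMeasures hs
  have := hmem.1
  refine ⟨hmem, ⟨_, hmem, rfl⟩, ?_⟩
  rintro _ ⟨m, ⟨_, hm⟩, rfl⟩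
  rw [hg.ksEntropy_add_integral_logEval hs
    (hg.integrable_logEval hs (g.integrable_neg_log_bernoulliWeight _))]
  exact hg.ksEntropy_add_integral_logEval_le hs hm

end FiniteAlphabet

end Potential

/-! ### The eigenfunction -/

section IndependentSeries

open ProbabilityTheory

variable {Ω : Type*} [MeasurableSpace Ω] {P : Measure Ω} {X : ℕ → Ω → ℝ}

lemma martingale_sum_of_iIndepFun (hX : ∀ i, StronglyMeasurable (X i))
    (hint : ∀ i, Integrable (X i) P) (hind : iIndepFun X P) (hmean : ∀ i, ∫ ω, X i ω ∂P = 0) :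
    Martingale (fun n => ∑ i ∈ Finset.range (n + 1), X i) (Filtration.natural X hX) P := by
  have := hind.isProbabilityMeasure
  refine martingale_of_condExp_sub_eq_zero_nat (fun n => Finset.stronglyMeasurable_sum _ fun i hi =>
      (Filtration.stronglyAdapted_natural hX i).mono
        ((Filtration.natural X hX).mono (Nat.lt_succ_iff.1 (Finset.mem_range.1 hi))))
    (fun n => integrable_finsetSum' _ fun i _ => hint i) fun n => ?_
  rw [Finset.sum_range_succ _ (n + 1), add_sub_cancel_left]
  exact (hind.condExp_natural_ae_eq_of_lt hX n.lt_succ_self).trans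
    (ae_of_all _ fun _ => hmean (n + 1))

lemma integral_sq_sum_of_iIndepFun (hL2 : ∀ i, MemLp (X i) 2 P) (hind : iIndepFun X P)
    (hmean : ∀ i, ∫ ω, X i ω ∂P = 0) (n : ℕ) :
    ∫ ω, (∑ i ∈ Finset.range n, X i) ω ^ 2 ∂P = ∑ i ∈ Finset.range n, ∫ ω, X i ω ^ 2 ∂P := by
  have := hind.isProbabilityMeasure
  have hint (i : ℕ) : Integrable (X i) P := (hL2 i).integrable one_le_two
  have hmean_sum : ∫ ω, (∑ i ∈ Finset.range n, X i) ω ∂P = 0 := by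
    simp only [Finset.sum_apply]
    rw [integral_finsetSum _ fun i _ => hint i]
    exact Finset.sum_eq_zero fun i _ => hmean i
  rw [← variance_of_integral_eq_zero
      (integrable_finsetSum' _ fun i _ => hint i).aemeasurable hmean_sum,
    IndepFun.variance_sum (fun i _ => hL2 i) fun i _ j _ hij => hind.indepFun hij]
  exact Finset.sum_congr rfl fun i _ => variance_of_integral_eq_zero (hint i).aemeasurable (hmean i)

lemma eLpNorm_one_le_ofReal_sqrt [IsProbabilityMeasure P] {f : Ω → ℝ} (hf : MemLp f 2 P) :
    eLpNorm f 1 P ≤ ENNReal.ofReal √(∫ ω, f ω ^ 2 ∂P) := by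
  refine (eLpNorm_le_eLpNorm_of_exponent_le one_le_two hf.aestronglyMeasurable).trans_eq ?_
  rw [hf.eLpNorm_eq_integral_rpow_norm two_ne_zero ENNReal.ofNat_ne_top, Real.sqrt_eq_rpow]
  simp

lemma ae_exists_tendsto_sum_of_iIndepFun (hX : ∀ i, Measurable (X i))
    (hL2 : ∀ i, MemLp (X i) 2 P) (hind : iIndepFun X P) (hmean : ∀ i, ∫ ω, X i ω ∂P = 0)
    (hsum : Summable fun i => ∫ ω, X i ω ^ 2 ∂P) :
    ∀ᵐ ω ∂P, ∃ c, Tendsto (fun n => ∑ i ∈ Finset.range n, X i ω) atTop (𝓝 c) := by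
  have := hind.isProbabilityMeasure
  have hmart := martingale_sum_of_iIndepFun (fun i => (hX i).stronglyMeasurable)
    (fun i => (hL2 i).integrable one_le_two) hind hmean
  have hbdd (n : ℕ) : eLpNorm (∑ i ∈ Finset.range (n + 1), X i) 1 P ≤
      (√(∑' i, ∫ ω, X i ω ^ 2 ∂P)).toNNReal := by
    refine (eLpNorm_one_le_ofReal_sqrt (memLp_finsetSum' _ fun i _ => hL2 i)).trans
      (ENNReal.ofReal_le_ofReal (Real.sqrt_le_sqrt ?_))
    rw [integral_sq_sum_of_iIndepFun hL2 hind hmean]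
    exact hsum.sum_le_tsum _ fun i _ => integral_nonneg fun _ => sq_nonneg _
  filter_upwards [hmart.submartingale.exists_ae_tendsto_of_bdd hbdd] with ω ⟨c, hc⟩
  refine ⟨c, (tendsto_add_atTop_iff_nat 1).1 ?_⟩
  simpa only [Finset.sum_apply] using hc

end IndependentSeries

namespace Potential

variable {A : Type*} {g : Potential A}

namespace L1Bounded

lemma summable_log_factor_tail (hg : g.L1Bounded) (i : ℕ) (a : A) :
    Summable fun k => Real.log (g.factor (i + 1 + k) a) :=
  .of_norm_bounded (hg.summable_logBound_add i) fun k => by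
    rw [add_right_comm]
    exact hg.abs_log_factor_le (i + k) a

lemma eigenFactor_eq (hg : g.L1Bounded) (i : ℕ) (a : A) :
    g.eigenFactor i a = Real.exp (∑' k, Real.log (g.factor (i + 1 + k) a)) :=
  (Real.rexp_tsum_eq_tprod (fun _ => g.factor_pos _ a) (hg.summable_log_factor_tail i a)).symm

lemma eigenFactor_pos (hg : g.L1Bounded) (i : ℕ) (a : A) : 0 < g.eigenFactor i a := by
  rw [hg.eigenFactor_eq]
  exact Real.exp_pos _

lemma log_eigenFactor (hg : g.L1Bounded) (i : ℕ) (a : A) :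
    Real.log (g.eigenFactor i a) = ∑' k, Real.log (g.factor (i + 1 + k) a) := by
  rw [hg.eigenFactor_eq, Real.log_exp]

lemma eigenFactor_eq_mul (hg : g.L1Bounded) (i : ℕ) (a : A) :
    g.eigenFactor i a = g.factor (i + 1) a * g.eigenFactor (i + 1) a := by
  have hmul : Multipliable fun k => g.factor (i + 1 + (k + 1)) a := by
    refine Real.multipliable_of_summable_log (fun _ => g.factor_pos _ a)
      ((hg.summable_log_factor_tail (i + 1) a).congr fun k => ?_)
    rw [add_assoc, add_comm 1 k]
  rw [eigenFactor, tprod_eq_zero_mul' hmul, eigenFactor]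
  simp only [add_zero, add_assoc, add_comm 1]

lemma tendsto_partialEval (hg : g.L1Bounded) (x : Seq A) :
    Tendsto (fun n => g.partialEval n x) atTop (𝓝 (g.eval x)) := by
  have hmul := Real.multipliable_of_summable_log (fun n => g.factor_pos n (x n))
    (hg.summable_log_factor x)
  exact (hmul.tendsto_prod_tprod_nat.comp (tendsto_add_atTop_nat 1)).const_mul g.const

lemma eval_const_eq_mul_eigenFactor (hg : g.L1Bounded) (a : A) :
    g.eval (fun _ => a) = g.const * (g.factor 0 a * g.eigenFactor 0 a) := by
  have hmul : Multipliable fun k => g.factor (k + 1) a :=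
    Real.multipliable_of_summable_log (fun _ => g.factor_pos _ a)
      ((hg.summable_log_factor_tail 0 a).congr fun k => by rw [zero_add, add_comm])
  rw [eval, tprod_eq_zero_mul' hmul, eigenFactor]
  simp only [zero_add, add_comm 1]

lemma prod_eigenFactor_cons_mul_partialEval (hg : g.L1Bounded) (a : A) (x : Seq A) (n : ℕ) :
    (∏ i ∈ Finset.range (n + 1), g.eigenFactor i (cons a x i)) * g.partialEval n (cons a x) =
      g.eval (fun _ => a) * ∏ i ∈ Finset.range n, g.eigenFactor i (x i) := by
  induction n with
  | zero =>
    simp only [partialEval, zero_add, Finset.prod_range_one, Finset.prod_range_zero, cons_zero,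
      hg.eval_const_eq_mul_eigenFactor]
    ring
  | succ n ih =>
    rw [Finset.prod_range_succ _ (n + 1), partialEval_succ, mul_mul_mul_comm, ih,
      Finset.prod_range_succ _ n, cons_succ, hg.eigenFactor_eq_mul n]
    ring

lemma eigenfunctionHasValue_cons (hg : g.L1Bounded) {x : Seq A} {c : ℝ}
    (hc : g.EigenfunctionHasValue x c) (a : A) :
    g.EigenfunctionHasValue (cons a x) (g.eval (fun _ => a) * c / g.eval (cons a x)) := by
  refine ⟨div_pos (mul_pos (hg.eval_pos _) hc.1) (hg.eval_pos _),
    (tendsto_add_atTop_iff_nat 1).1 ?_⟩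
  refine ((hc.2.const_mul _).div (hg.tendsto_partialEval (cons a x))
    (hg.eval_pos _).ne').congr fun n => ?_
  rw [Pi.div_apply, ← hg.prod_eigenFactor_cons_mul_partialEval,
    mul_div_cancel_right₀ _ (partialEval_pos n _).ne']

lemma eigenfunctionExistsAt_of_shift (hg : g.L1Bounded) {y : Seq A}
    (hy : g.EigenfunctionExistsAt (shift y)) : g.EigenfunctionExistsAt y := by
  obtain ⟨c, hc⟩ := hy
  have hcons := hg.eigenfunctionHasValue_cons hc (y 0)
  rw [cons_shift] at hcons
  exact ⟨_, hcons⟩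

lemma ruelle_eigenfunction (hg : g.L1Bounded) {x : Seq A} (hx : g.EigenfunctionExistsAt x) :
    ruelle g.logEval g.eigenfunction x = g.eigenvalue * g.eigenfunction x := by
  obtain ⟨c, hc⟩ := hx
  rw [ruelle_eq_tsum, eigenvalue_eq_tsum, ← tsum_mul_right]
  refine tsum_congr fun a => ?_
  rw [eigenfunction, eigenfunction, (hg.eigenfunctionHasValue_cons hc a).2.limUnder_eq,
    hc.2.limUnder_eq, hg.exp_logEval, div_mul_cancel₀ _ (hg.eval_pos _).ne']

lemma sum_log_eigenFactor [Fintype A] (hg : g.L1Bounded) (hb : g.Balanced) (i : ℕ) :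
    ∑ a, Real.log (g.eigenFactor i a) = 0 := by
  simp only [hg.log_eigenFactor]
  rw [← Summable.tsum_finsetSum fun a _ => hg.summable_log_factor_tail i a]
  refine (tsum_congr fun k => ?_).trans tsum_zero
  rw [← Real.log_prod fun a _ => (g.factor_pos _ a).ne', hb, Real.log_one]

lemma exists_summable_bound_log_eigenFactor_sq (hg : g.L1Bounded) (h2 : g.L2BoundedTails) :
    ∃ (k : ℕ) (v : ℕ → ℝ), Summable v ∧ ∀ i a, Real.log (g.eigenFactor (i + k) a) ^ 2 ≤ v i := by
  obtain ⟨k, hk⟩ := h2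
  refine ⟨k, _, (summable_nat_add_iff 1).2 (ENNReal.summable_toReal hk.ne), fun i a => ?_⟩
  have hle := ENNReal.toReal_mono (ENNReal.ne_top_of_tsum_ne_top hk.ne (i + 1))
    (le_iSup (fun a : A => ENNReal.ofReal
      ((∑' j : ℕ, Real.log (g.factor (k + (i + 1) + j) a)) ^ 2)) a)
  rw [hg.log_eigenFactor, show i + k + 1 = k + (i + 1) by ring]
  rwa [ENNReal.toReal_ofReal (sq_nonneg _)] at hle

lemma eigenfunctionExistsAt_of_tendsto_sum_log (hg : g.L1Bounded) {x : Seq A} {c : ℝ}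
    (hc : Tendsto (fun n => ∑ i ∈ Finset.range n, Real.log (g.eigenFactor i (x i))) atTop (𝓝 c)) :
    g.EigenfunctionExistsAt x := by
  refine ⟨Real.exp c, Real.exp_pos c, ((Real.continuous_exp.tendsto c).comp hc).congr fun n => ?_⟩
  rw [Function.comp_apply, Real.exp_sum]
  exact Finset.prod_congr rfl fun i _ => Real.exp_log (hg.eigenFactor_pos i _)

end L1Bounded

end Potential

section UniformBernoulli

variable {A : Type*} [Fintype A] [Nonempty A]

lemma isProbabilityVector_uniform : IsProbabilityVector fun _ : A => 1 / (Fintype.card A : ℝ) where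
  nonneg _ := by positivity
  hasSum := by simpa using hasSum_fintype fun _ : A => 1 / (Fintype.card A : ℝ)

variable [MeasurableSpace A] [MeasurableSingletonClass A]

lemma integral_apply_uniformBernoulli (f : A → ℝ) (i : ℕ) :
    ∫ x, f (x i) ∂uniformBernoulli A = (1 / (Fintype.card A : ℝ)) * ∑ a, f a := by
  have huniform := isProbabilityVector_uniform (A := A)
  have := huniform.isProbabilityMeasure_letterMeasure
  rw [uniformBernoulli, integral_comp_of_measurePreserving
      (measurePreserving_eval_productMeasure (fun _ => huniform) i)
      Measurable.of_discrete.aestronglyMeasurable, integral_fintype .of_finite, Finset.mul_sum]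
  refine Finset.sum_congr rfl fun a _ => ?_
  rw [measureReal_def, letterMeasure_singleton, ENNReal.toReal_ofReal (huniform.nonneg a),
    smul_eq_mul]

namespace Potential.L1Bounded

variable {g : Potential A}

omit [MeasurableSingletonClass A] in
lemma summable_integral_log_eigenFactor_sq (hg : g.L1Bounded) (h2 : g.L2BoundedTails) :
    Summable fun i => ∫ x, Real.log (g.eigenFactor i (x i)) ^ 2 ∂uniformBernoulli A := by
  have : IsProbabilityMeasure (uniformBernoulli A) :=
    isProbabilityMeasure_productMeasure fun _ => isProbabilityVector_uniform
  obtain ⟨k, v, hv, hle⟩ := hg.exists_summable_bound_log_eigenFactor_sq h2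
  rw [← summable_nat_add_iff k]
  refine hv.of_nonneg_of_le (fun i => integral_nonneg fun _ => sq_nonneg _) fun i => ?_
  exact (integral_mono_of_nonneg (ae_of_all _ fun _ => sq_nonneg _) (integrable_const (v i))
    (ae_of_all _ fun x => hle i _)).trans_eq (by simp)

lemma ae_eigenfunctionExistsAt (hg : g.L1Bounded) (hb : g.Balanced) (h2 : g.L2BoundedTails) :
    ∀ᵐ x ∂uniformBernoulli A, g.EigenfunctionExistsAt x := by
  have huniform := isProbabilityVector_uniform (A := A)
  have := huniform.isProbabilityMeasure_letterMeasure
  have hmeas (i : ℕ) : Measurable fun x : Seq A => Real.log (g.eigenFactor i (x i)) :=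
    (Measurable.of_discrete (f := fun a => Real.log (g.eigenFactor i a))).comp
      (measurable_pi_apply i)
  have hL2 (i : ℕ) : MemLp (fun x : Seq A => Real.log (g.eigenFactor i (x i))) 2
      (uniformBernoulli A) :=
    (MemLp.of_discrete (f := fun a => Real.log (g.eigenFactor i a))).comp_measurePreserving
      (measurePreserving_eval_productMeasure (fun _ => huniform) i)
  have hmean (i : ℕ) : ∫ x, Real.log (g.eigenFactor i (x i)) ∂uniformBernoulli A = 0 := by
    rw [integral_apply_uniformBernoulli fun a => Real.log (g.eigenFactor i a),
      hg.sum_log_eigenFactor hb, mul_zero]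
  have hind : ProbabilityTheory.iIndepFun (fun i (x : Seq A) => Real.log (g.eigenFactor i (x i)))
      (uniformBernoulli A) :=
    ProbabilityTheory.iIndepFun_infinitePi (X := fun i a => Real.log (g.eigenFactor i a))
      fun i => .of_discrete
  filter_upwards [ae_exists_tendsto_sum_of_iIndepFun hmeas hL2 hind hmean
    (hg.summable_integral_log_eigenFactor_sq h2)] with x ⟨c, hc⟩
  exact hg.eigenfunctionExistsAt_of_tendsto_sum_log hc

end Potential.L1Bounded

end UniformBernoulli

end ProductType

end

theorem theorem4p2 {A : Type*} [Countable A] [Nonempty A] [TopologicalSpace A]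
    [DiscreteTopology A] [MeasurableSpace A] [BorelSpace A]
    (g : ProductType.Potential A) (hg₁ : g.L1Bounded) (hgs : g.IsSummable) :
    -- `μ` and `μ̃` are probability measures, and `μ̃` is shift invariant
    (MeasureTheory.IsProbabilityMeasure g.conformalMeasure ∧
      g.bernoulliMeasure ∈ ProductType.invariantMeasures A) ∧
    -- `L_{log g}^* μ = λ μ`
    ProductType.IsDualImage g.logEval g.conformalMeasure
      (ENNReal.ofReal g.eigenvalue • g.conformalMeasure) ∧
    -- `L_{log g̃}^* μ̃ = μ̃`
    ProductType.IsDualImage g.logNormalized g.bernoulliMeasure g.bernoulliMeasure ∧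
    -- `0 < λ` and `P(log g) = log λ`
    (0 < g.eigenvalue ∧ ProductType.HasPressure g.logEval (Real.log g.eigenvalue : ℝ)) ∧
    -- `∫ log g dμ̃` exists in `[-∞, ∞)`, and `h_{μ̃}(T) = log λ - ∫ log g dμ̃` in `[0, ∞]`
    (∫⁻ x, ENNReal.ofReal (g.logEval x) ∂g.bernoulliMeasure ≠ ⊤ ∧
      ProductType.ksEntropy g.bernoulliMeasure ProductType.shift =
        (Real.log g.eigenvalue : EReal) -
          ProductType.extIntegral g.bernoulliMeasure g.logEval) ∧
    -- hence `P(log g) = h_{μ̃}(T) + ∫ log g dμ̃`, unless the right-hand side reads `∞ - ∞`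
    (ProductType.ksEntropy g.bernoulliMeasure ProductType.shift ≠ ⊤ →
      MeasureTheory.Integrable g.logEval g.bernoulliMeasure ∧
      ProductType.HasPressure g.logEval
        (ProductType.ksEntropy g.bernoulliMeasure ProductType.shift +
          ((∫ x, g.logEval x ∂g.bernoulliMeasure : ℝ) : EReal))) ∧
    -- for a finite alphabet the entropy is finite and `μ̃` is an equilibrium state
    (Finite A →
      ProductType.ksEntropy g.bernoulliMeasure ProductType.shift ≠ ⊤ ∧
      ProductType.IsEquilibriumState g.logEval g.bernoulliMeasure) ∧
    -- the eigenfunction, for a finite alphabet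
    (∀ [Fintype A], g.Balanced → g.L2BoundedTails →
      (∀ᵐ x ∂(ProductType.uniformBernoulli A), g.EigenfunctionExistsAt x) ∧
      ∀ x, g.EigenfunctionExistsAt x →
        (∀ y, ProductType.shift y = x → g.EigenfunctionExistsAt y) ∧
        ProductType.ruelle g.logEval g.eigenfunction x = g.eigenvalue * g.eigenfunction x) := by
  obtain ⟨hprob, hinv⟩ := hg₁.bernoulliMeasure_mem_invariantMeasures hgs
  refine ⟨⟨hg₁.isProbabilityMeasure_conformalMeasure hgs, hprob, hinv⟩,
    hg₁.isDualImage_logEval hgs, hg₁.isDualImage_logNormalized hgs,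
    ⟨hg₁.eigenvalue_pos hgs, hg₁.hasPressure_logEval hgs⟩,
    ⟨hg₁.lintegral_logEval_ne_top hgs _, hg₁.ksEntropy_bernoulliMeasure_eq_sub hgs⟩,
    fun hfin => ?_,
    fun _ => ⟨hg₁.ksEntropy_bernoulliMeasure_ne_top hgs,
      hg₁.isEquilibriumState_bernoulliMeasure hgs⟩,
    fun hb h2 => ⟨hg₁.ae_eigenfunctionExistsAt hb h2,
      fun x hx => ⟨?_, hg₁.ruelle_eigenfunction hx⟩⟩⟩
  · have hint := hg₁.integrable_logEval_of_ksEntropy_ne_top hgs hfin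
    rw [hg₁.ksEntropy_add_integral_logEval hgs hint]
    exact ⟨hint, hg₁.hasPressure_logEval hgs⟩
  · rintro y rfl
    exact hg₁.eigenfunctionExistsAt_of_shift hx
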